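/- For integers $d\ge 1$ and $k\ge 1$, a lattice $(d,k)$-polytope is the convex hull of a nonempty finite set of points of $\mathbb{Z}^d$ whose vertices all belong to $\{0,1,\dots,k\}^d$ (it need not be full-dimensional). Let $\delta(d,k)$ denote the largest possible diameter of the graph (formed by the vertices and edges) of a lattice $(d,k)$-polytope. Then, for every $d\ge 1$: (i) $\delta(d,k)\le kd-\lceil 2d/3\rceil-(k-2)$ for every $k\ge 4$; (ii) $\delta(d,3)\le\lfloor 7d/3\rfloor-1$ when $d\not\equiv 2\pmod 3$; (iii) $\delta(d,3)\le\lfloor 7d/3\rfloor$ when $d\equiv 2\pmod 3$. -/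

import Mathlib

/-- A lattice polytope in `ℝ^d`: the convex hull of a nonempty finite set of points all of whose
coordinates are integers. -/
def IsLatticePolytope {d : ℕ} (P : Set (Fin d → ℝ)) : Prop :=
  ∃ S : Set (Fin d → ℝ), S.Finite ∧ S.Nonempty ∧ (∀ x ∈ S, ∀ i, ∃ z : ℤ, x i = z) ∧
    P = convexHull ℝ S

/-- The vertices of a polytope are its extreme points. -/
def polytopeVertices {d : ℕ} (P : Set (Fin d → ℝ)) : Set (Fin d → ℝ) :=
  Set.extremePoints ℝ P

/-- A lattice `(d,k)`-polytope: a lattice polytope in `ℝ^d` (of any dimension at most `d`) all of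
whose vertices belong to `{0, 1, …, k}^d`. -/
def IsLatticeDKPolytope (d k : ℕ) (P : Set (Fin d → ℝ)) : Prop :=
  IsLatticePolytope P ∧ ∀ x ∈ polytopeVertices P, ∀ i, ∃ n : ℕ, n ≤ k ∧ x i = n

/-- The graph of a polytope: two distinct vertices are adjacent when the segment between them is
an edge, that is, a one-dimensional face. (The nonempty convex extreme subsets of a polytope are
exactly its nonempty faces.) -/
def polytopeGraph {d : ℕ} (P : Set (Fin d → ℝ)) : SimpleGraph (polytopeVertices P) where
  Adj u v := u ≠ v ∧ IsExtreme ℝ P (segment ℝ (u : Fin d → ℝ) (v : Fin d → ℝ))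
  symm := ⟨fun u v h => ⟨h.1.symm, by
    rw [segment_symm]
    exact h.2⟩⟩
  loopless := ⟨fun _ h => h.1 rfl⟩

/-- The diameter `δ(P)` of a polytope: the diameter of its graph. It is valued in `ℕ∞`, so that
it would be `⊤` if the graph were disconnected. -/
noncomputable def polytopeDiam {d : ℕ} (P : Set (Fin d → ℝ)) : ℕ∞ :=
  (polytopeGraph P).ediam

/-- The largest possible diameter `δ(d,k)` of a lattice `(d,k)`-polytope. -/
noncomputable def maxLatticeDiam (d k : ℕ) : ℕ∞ :=
  sSup {n : ℕ∞ | ∃ P : Set (Fin d → ℝ), IsLatticeDKPolytope d k P ∧ polytopeDiam P = n}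

/-!
A vertex that is not minimal for an integral linear functional has a neighbour with a smaller
value, so it reaches the face on which a coordinate is minimal within as many steps as its height
above that face. Two vertices `u` and `v` can therefore be joined through either of the two faces
orthogonal to a coordinate direction, and the shorter of the two routes uses at most `k` steps
outside a face that has one direction less (`DiamBound.succ`). The bounds follow from the
recursion `DiamBound.add_three`: for `k ≥ 3`, either one step is saved in one direction, or two
steps are saved in two directions, or two steps are saved in three directions.

To prove the recursion, a pair `u`, `v` violating it is considered (`IsVeryFarPair`). Every descent
to a wall of the cube is then tight: its steps have length one, and `u + v = (k, …, k)`. A route to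
the intersection of two or three walls may save one step, but not two. If a path from `u` saves a
step on the way to two walls, then a descent of `v` to these walls saves nothing: it is a lattice
chain in a plane along which the sum of the two heights drops by exactly one in each step. Convexity
allows such a chain at most two steps, so `v` has height at most one above both walls
(`heights_le_one`). It follows that every edge at `u` is parallel to an axis (`not_double`), hence
that `u` and `v` are opposite corners of the cube. A path from `u` to a
wall through `v` then has to turn off in some other direction, which yields a planar face through
two opposite corners of a square of side `k`, and the convex chain between them leads to a
contradiction (`IsVeryFarPair.false`).

The recursion starts from segments (`diamBound_one`) and polygons (`diamBound_two`). For `k ≥ 4`, a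
polygon of diameter greater than `k` would have two vertices on every vertical lattice line. The
lengths of the vertical slices would form a strictly concave sequence with second differences at
most `-2`, which exceeds `k` in the middle. For `k = 3` the value in three dimensions comes from a
simpler recursion, `DiamBound.add_two`.

All of this takes place in finite sets of integer points in convex position, with edges defined by
supporting functionals. The recursion passes only to faces on which a coordinate is constant, so the
number of coordinates that may vary serves as a substitute for the dimension and no projections are
needed.
-/

/-! ### Finite sets of lattice points and their edge graphs -/

/-- `p` is exposed in the finite set `V`: some linear functional attains its minimum over `V`
only at `p`. When every point of `V` is exposed, `V` is the vertex set of its convex hull. -/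
def IsExposedPoint {ι : Type*} (V : Finset (ι → ℤ)) (p : ι → ℤ) : Prop :=
  ∃ φ : (ι → ℤ) →+ ℝ, ∀ x ∈ V, x ≠ p → φ p < φ x

/-- The graph on lattice points in which `p` and `q` are adjacent when both belong to `V` and some
linear functional attains its minimum over `V` exactly at `p` and `q`. -/
def edgeGraph {ι : Type*} (V : Finset (ι → ℤ)) : SimpleGraph (ι → ℤ) where
  Adj p q := p ≠ q ∧ p ∈ V ∧ q ∈ V ∧
    ∃ φ : (ι → ℤ) →+ ℝ, φ p = φ q ∧ ∀ x ∈ V, x ≠ p → x ≠ q → φ p < φ x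
  symm := ⟨fun _ _ ⟨h, hp, hq, φ, h1, h2⟩ =>
    ⟨h.symm, hq, hp, φ, h1.symm, fun x hx h3 h4 => h1 ▸ h2 x hx h4 h3⟩⟩
  loopless := ⟨fun _ h => h.1 rfl⟩

/-- `Reach V n u v`: the points `u` and `v` are joined in the edge graph of `V` by a walk with at
most `n` steps. The bound is an integer, so that the bookkeeping of lengths needs no truncated
subtraction. -/
def Reach {ι : Type*} (V : Finset (ι → ℤ)) (n : ℤ) (u v : ι → ℤ) : Prop :=
  ∃ p : (edgeGraph V).Walk u v, (p.length : ℤ) ≤ n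

/-- An integer-valued affine functional on the lattice. -/
def IsAffine {ι : Type*} (c : (ι → ℤ) → ℤ) : Prop :=
  ∃ (l : (ι → ℤ) →+ ℤ) (b : ℤ), ∀ x, c x = l x + b

/-- `G` is the set of points of `V` at which some integer-valued affine functional is minimal. -/
def IsFace {ι : Type*} (G V : Finset (ι → ℤ)) : Prop :=
  ∃ (c : (ι → ℤ) → ℤ) (m : ℤ), IsAffine c ∧ (∀ x ∈ V, m ≤ c x) ∧
    ∀ x, x ∈ G ↔ x ∈ V ∧ c x = m

section

variable {ι : Type*} {V G : Finset (ι → ℤ)}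

theorem Reach.refl (u : ι → ℤ) : Reach V 0 u u := ⟨SimpleGraph.Walk.nil, by simp⟩

theorem Reach.of_adj {u v : ι → ℤ} (h : (edgeGraph V).Adj u v) : Reach V 1 u v :=
  ⟨h.toWalk, by simp⟩

theorem Reach.mono {u v : ι → ℤ} {m n : ℤ} (h : Reach V m u v) (hmn : m ≤ n) : Reach V n u v := by
  obtain ⟨p, hp⟩ := h
  exact ⟨p, hp.trans hmn⟩

theorem Reach.symm {u v : ι → ℤ} {n : ℤ} (h : Reach V n u v) : Reach V n v u := by
  obtain ⟨p, hp⟩ := h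
  exact ⟨p.reverse, by simpa using hp⟩

theorem Reach.trans {u v w : ι → ℤ} {m n : ℤ} (h : Reach V m u v) (h' : Reach V n v w) :
    Reach V (m + n) u w := by
  obtain ⟨p, hp⟩ := h
  obtain ⟨q, hq⟩ := h'
  exact ⟨p.append q, by rw [SimpleGraph.Walk.length_append]; push_cast; omega⟩

theorem IsAffine.add {c d : (ι → ℤ) → ℤ} (hc : IsAffine c) (hd : IsAffine d) :
    IsAffine fun x => c x + d x := by
  obtain ⟨l, b, h⟩ := hc
  obtain ⟨l', b', h'⟩ := hd
  exact ⟨l + l', b + b', fun x => by simp only [h, h', AddMonoidHom.add_apply]; ring⟩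

theorem IsAffine.sum {κ : Type*} (s : Finset κ) {c : κ → (ι → ℤ) → ℤ}
    (hc : ∀ j, IsAffine (c j)) : IsAffine fun x => ∑ j ∈ s, c j x := by
  classical
  induction s using Finset.induction_on with
  | empty => exact ⟨0, 0, fun x => by simp⟩
  | insert j s hj ih =>
    simp only [Finset.sum_insert hj]
    exact (hc j).add ih

theorem IsFace.subset (h : IsFace G V) : G ⊆ V := by
  obtain ⟨c, m, -, -, h⟩ := h
  exact fun x hx => ((h x).1 hx).1

theorem IsExposedPoint.anti {p : ι → ℤ} (h : IsExposedPoint V p) (hGV : G ⊆ V) :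
    IsExposedPoint G p := by
  obtain ⟨φ, hφ⟩ := h
  exact ⟨φ, fun x hx => hφ x (hGV hx)⟩

/-- Edges of a face are edges: a large multiple of the functional defining the face is added to
the functional that exposes the edge within the face. -/
theorem IsFace.edgeGraph_le (h : IsFace G V) : edgeGraph G ≤ edgeGraph V := by
  have hsub := h.subset
  obtain ⟨c, m, ⟨l, b, hl⟩, hm, hG⟩ := h
  rintro p q ⟨hne, hp, hq, φ, hpq, hφ⟩
  obtain ⟨M, hM⟩ : ∃ M : ℝ, ∀ x ∈ V, φ p - φ x < M := by
    obtain ⟨M, hM⟩ := (V.image fun x => φ p - φ x).exists_le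
    exact ⟨M + 1, fun x hx => by
      have := hM _ (Finset.mem_image_of_mem _ hx); linarith⟩
  have hM0 : 0 < M := by simpa using hM p (hsub hp)
  have hcp := ((hG p).1 hp).2
  have hcq := ((hG q).1 hq).2
  rw [hl] at hcp hcq
  let ψ : (ι → ℤ) →+ ℝ :=
    (AddMonoidHom.mulLeft M).comp ((Int.castAddHom ℝ).comp l) + φ
  have hψ : ∀ x, ψ x = M * (l x : ℝ) + φ x := fun x => rfl
  refine ⟨hne, hsub hp, hsub hq, ψ, ?_, fun x hx hxp hxq => ?_⟩
  · rw [hψ, hψ, hpq, show l p = l q by omega]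
  · rw [hψ, hψ]
    by_cases hxG : x ∈ G
    · have h1 := ((hG x).1 hxG).2
      rw [hl] at h1
      rw [show l p = l x by omega]
      have := hφ x hxG hxp hxq
      linarith
    · have h1 : m + 1 ≤ c x := by
        have h2 := hm x hx
        have h3 : c x ≠ m := fun h => hxG ((hG x).2 ⟨hx, h⟩)
        omega
      rw [hl] at h1
      have h2 : (l p : ℝ) + 1 ≤ (l x : ℝ) := by exact_mod_cast (by omega : l p + 1 ≤ l x)
      have := hM x hx
      nlinarith

theorem Reach.of_face (h : IsFace G V) {u v : ι → ℤ} {n : ℤ} (hr : Reach G n u v) :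
    Reach V n u v := by
  obtain ⟨p, hp⟩ := hr
  exact ⟨p.mapLe h.edgeGraph_le, by simpa using hp⟩

/-- An exposed point is not a convex combination of two other points. -/
theorem IsExposedPoint.eq_of_combination {p x y : ι → ℤ} (hp : IsExposedPoint V p) (hx : x ∈ V)
    (hy : y ∈ V) {α β : ℤ} (hα : 0 < α) (hβ : 0 ≤ β) (h : α • x + β • y = (α + β) • p) : x = p := by
  obtain ⟨φ, hφ⟩ := hp
  by_contra hne
  have h1 := congrArg φ h
  rw [map_add, map_zsmul, map_zsmul, map_zsmul] at h1
  simp only [zsmul_eq_mul, Int.cast_add] at h1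
  have h2 := hφ x hx hne
  have h3 : φ p ≤ φ y := by
    by_cases hyp : y = p
    · rw [hyp]
    · exact (hφ y hy hyp).le
  have h4 : (0 : ℝ) < α := by exact_mod_cast hα
  have h5 : (0 : ℝ) ≤ β := by exact_mod_cast hβ
  nlinarith

/-! ### Monotone paths -/

/-- A functional that is positive on a finite set `S` can be perturbed so that it remains
positive on `S` and vanishes at none of finitely many given nonzero vectors. -/
theorem exists_generic (S Y : Finset (ι → ℤ)) (hY : ∀ y ∈ Y, y ≠ 0) (φ : (ι → ℤ) →+ ℝ)
    (hφ : ∀ x ∈ S, 0 < φ x) :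
    ∃ ψ : (ι → ℤ) →+ ℝ, (∀ x ∈ S, 0 < ψ x) ∧ ∀ y ∈ Y, ψ y ≠ 0 := by
  classical
  induction Y using Finset.induction_on with
  | empty => exact ⟨φ, hφ, by simp⟩
  | insert y Y hy ih =>
    obtain ⟨ψ, h1, h2⟩ := ih fun z hz => hY z (Finset.mem_insert_of_mem hz)
    obtain ⟨i, hi⟩ := Function.ne_iff.1 (hY y (Finset.mem_insert_self _ _))
    let e : (ι → ℤ) →+ ℝ := (Int.castAddHom ℝ).comp (Pi.evalAddMonoidHom _ i)
    have he : e y ≠ 0 := by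
      change ((y i : ℤ) : ℝ) ≠ 0
      exact_mod_cast hi
    have hcont : ∀ x, Filter.Tendsto (fun ε : ℝ => ψ x + ε * e x) (nhdsWithin 0 (Set.Ioi 0))
        (nhds (ψ x)) := by
      intro x
      have : Continuous fun ε : ℝ => ψ x + ε * e x := by fun_prop
      have h3 := this.tendsto 0
      simp only [zero_mul, add_zero] at h3
      exact h3.mono_left nhdsWithin_le_nhds
    have hpos : ∀ᶠ ε : ℝ in nhdsWithin 0 (Set.Ioi 0), ∀ x ∈ S, 0 < ψ x + ε * e x := by
      rw [Filter.eventually_all_finset]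
      exact fun x hx => (hcont x).eventually_const_lt (h1 x hx)
    have hne : ∀ᶠ ε : ℝ in nhdsWithin 0 (Set.Ioi 0), ∀ z ∈ Y, ψ z + ε * e z ≠ 0 := by
      rw [Filter.eventually_all_finset]
      exact fun z hz => (hcont z).eventually_ne (h2 z hz)
    have hy' : ∀ᶠ ε : ℝ in nhdsWithin 0 (Set.Ioi 0), ψ y + ε * e y ≠ 0 := by
      by_cases h0 : ψ y = 0
      · filter_upwards [self_mem_nhdsWithin] with ε hε
        rw [h0, zero_add]
        exact mul_ne_zero (ne_of_gt hε) he
      · exact (hcont y).eventually_ne h0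
    obtain ⟨ε, h3, h4, h5⟩ := (hpos.and (hne.and hy')).exists
    refine ⟨ψ + (AddMonoidHom.mulLeft ε).comp e, h3, fun z hz => ?_⟩
    rcases Finset.mem_insert.1 hz with rfl | hz
    · exact h5
    · exact h4 z hz

/-- The step of the simplex method: a vertex at which a functional is not minimal has a neighbour
at which the functional is smaller. Among the points `x` that improve `c`, a neighbour maximizes
the ratio `(c p - c x) / φ (x - p)`, where `φ` exposes `p` and is generic, so that the maximizer
is unique. -/
theorem exists_adj_lt (hV : ∀ p ∈ V, IsExposedPoint V p) {c : (ι → ℤ) → ℤ} (hc : IsAffine c)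
    {p x : ι → ℤ} (hp : p ∈ V) (hx : x ∈ V) (hlt : c x < c p) :
    ∃ q, (edgeGraph V).Adj p q ∧ c q < c p := by
  classical
  obtain ⟨l, b, hl⟩ := hc
  obtain ⟨φ₀, hφ₀⟩ := hV p hp
  let T := V.filter fun x => c x < c p
  let g : (ι → ℤ) × (ι → ℤ) → (ι → ℤ) :=
    fun z => (c p - c z.2) • (z.1 - p) - (c p - c z.1) • (z.2 - p)
  have key : ∀ x ∈ T, ∀ y ∈ T, g (x, y) = 0 → c x ≤ c y → x = y := by
    intro x hx y hy h hxy
    rw [Finset.mem_filter] at hx hy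
    simp only [g, sub_eq_zero] at h
    refine (hV y hy.1).eq_of_combination hx.1 hp (α := c p - c y) (β := c y - c x)
      (by omega) (by omega) ?_
    have h1 : (c p - c y + (c y - c x)) = c p - c x := by ring
    rw [h1]
    ext i
    have h2 := congrFun h i
    simp only [Pi.smul_apply, Pi.sub_apply, Pi.add_apply, smul_eq_mul] at h2 ⊢
    linear_combination h2
  have hg : ∀ x ∈ T, ∀ y ∈ T, x ≠ y → g (x, y) ≠ 0 := by
    intro x hx y hy hne h
    rcases le_total (c x) (c y) with hxy | hxy
    · exact hne (key x hx y hy h hxy)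
    · refine hne (key y hy x hx ?_ hxy).symm
      rw [show g (y, x) = -g (x, y) by simp [g], h, neg_zero]
  obtain ⟨ψ, hψpos, hψne⟩ := exists_generic ((V.erase p).image fun x => x - p)
    (((T ×ˢ T).filter fun z => z.1 ≠ z.2).image g)
    (by
      intro y hy
      obtain ⟨z, hz, rfl⟩ := Finset.mem_image.1 hy
      rw [Finset.mem_filter, Finset.mem_product] at hz
      exact hg z.1 hz.1.1 z.2 hz.1.2 hz.2) φ₀
    (by
      intro y hy
      obtain ⟨z, hz, rfl⟩ := Finset.mem_image.1 hy
      rw [Finset.mem_erase] at hz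
      rw [map_sub, sub_pos]
      exact hφ₀ z hz.2 hz.1)
  have hpos : ∀ x ∈ V, x ≠ p → 0 < ψ x - ψ p := by
    intro x hx hxp
    rw [← map_sub]
    exact hψpos _ (Finset.mem_image_of_mem _ (Finset.mem_erase.2 ⟨hxp, hx⟩))
  have hTne : ∀ x ∈ T, x ∈ V ∧ x ≠ p ∧ (c x : ℝ) < c p := by
    intro x hx
    have h := (Finset.mem_filter.1 hx)
    exact ⟨h.1, fun h' => by rw [h'] at h; exact lt_irrefl _ h.2, by exact_mod_cast h.2⟩
  obtain ⟨q, hq, hmax⟩ := T.exists_max_image (fun x => ((c p - c x : ℤ) : ℝ) / (ψ x - ψ p))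
    ⟨x, Finset.mem_filter.2 ⟨hx, hlt⟩⟩
  obtain ⟨hqV, hqp, hcq⟩ := hTne q hq
  have hdq := hpos q hqV hqp
  set r : ℝ := ((c p - c q : ℤ) : ℝ) / (ψ q - ψ p) with hr
  have hr0 : 0 < r := div_pos (by push_cast; linarith) hdq
  have hrq : r * (ψ q - ψ p) = c p - c q := by
    rw [hr, div_mul_cancel₀ _ hdq.ne']; push_cast; ring
  have hcl : ∀ x, (c x : ℝ) = l x + b := fun x => by rw [hl]; push_cast; ring
  let χ : (ι → ℤ) →+ ℝ := (AddMonoidHom.mulLeft r).comp ψ + (Int.castAddHom ℝ).comp l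
  have hχ : ∀ x, χ x = r * ψ x + l x := fun x => rfl
  refine ⟨q, ⟨hqp.symm, hp, hqV, χ, ?_, fun y hy hyp hyq => ?_⟩, (Finset.mem_filter.1 hq).2⟩
  · rw [hχ, hχ]
    have := hcl p
    have := hcl q
    linarith
  · rw [hχ, hχ]
    have h1 := hcl p
    have h2 := hcl y
    have hdy := hpos y hy hyp
    by_cases hyT : y ∈ T
    · have h3 := hmax y hyT
      rw [div_le_iff₀ hdy] at h3
      push_cast at h3
      have h4 : (c p : ℝ) - c y ≠ r * (ψ y - ψ p) := by
        intro h5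
        refine hψne (g (q, y)) (Finset.mem_image_of_mem _ (Finset.mem_filter.2
          ⟨Finset.mem_product.2 ⟨hq, hyT⟩, fun h => hyq h.symm⟩)) ?_
        simp only [g]
        rw [map_sub, map_zsmul, map_zsmul, zsmul_eq_mul, zsmul_eq_mul, map_sub, map_sub,
          Int.cast_sub, Int.cast_sub, h5, ← hrq]
        ring
      have h6 := lt_of_le_of_ne h3 h4
      linarith
    · have h3 : ¬ c y < c p := fun h => hyT (Finset.mem_filter.2 ⟨hy, h⟩)
      have h4 : (c p : ℝ) ≤ c y := by exact_mod_cast not_lt.1 h3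
      nlinarith [mul_pos hr0 hdy]

/-- A vertex reaches the face on which a functional `c` takes its minimal value `m` within
`c u - m` steps, because each step of the simplex method decreases `c` by at least one. -/
theorem exists_reach_min (hV : ∀ p ∈ V, IsExposedPoint V p) {c : (ι → ℤ) → ℤ} (hc : IsAffine c)
    {m : ℤ} (hm : ∀ x ∈ V, m ≤ c x) (hmin : ∃ x ∈ V, c x = m) {u : ι → ℤ} (hu : u ∈ V) :
    ∃ u' ∈ V, c u' = m ∧ Reach V (c u - m) u u' := by
  obtain ⟨x, hx, hxm⟩ := hmin
  induction h : (c u - m).toNat using Nat.strong_induction_on generalizing u with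
  | _ n ih =>
    rcases (hm u hu).eq_or_lt with h0 | h0
    · exact ⟨u, hu, h0.symm, (Reach.refl u).mono (by omega)⟩
    · obtain ⟨w, hw, hlt⟩ := exists_adj_lt hV hc hu hx (by omega)
      have hwV := hw.2.2.1
      have := hm w hwV
      obtain ⟨u', hu', h1, h2⟩ := ih (c w - m).toNat (by omega) hwV rfl
      exact ⟨u', hu', h1, ((Reach.of_adj hw).trans h2).mono (by omega)⟩

end

/-! ### Polytopes in a cube and their coordinate faces -/

/-- The height of `x` above a wall of the cube `[0, k]^ι` orthogonal to direction `i`: above the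
wall `x i = 0` if `s` is true, and above the wall `x i = k` otherwise. -/
def height {ι : Type*} (k : ℤ) (s : Bool) (i : ι) (x : ι → ℤ) : ℤ :=
  if s then x i else k - x i

/-- `V` is the vertex set of a lattice polytope contained in the cube `[0, k]^ι` on which every
coordinate outside `J` is constant. The cardinality of `J` plays the role of the dimension. -/
structure IsCubeVertexSet {ι : Type*} (k : ℤ) (J : Finset ι) (V : Finset (ι → ℤ)) : Prop where
  exposed : ∀ p ∈ V, IsExposedPoint V p
  cube : ∀ x ∈ V, ∀ i, 0 ≤ x i ∧ x i ≤ k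
  const : ∀ x ∈ V, ∀ y ∈ V, ∀ i, i ∉ J → x i = y i

/-- All lattice polytopes in the cube `[0, k]^ι` whose coordinates are constant outside some set of
`n` directions have diameter at most `N`. -/
def DiamBound (ι : Type*) (k : ℤ) (n : ℕ) (N : ℤ) : Prop :=
  ∀ (J : Finset ι) (V : Finset (ι → ℤ)), J.card = n → IsCubeVertexSet k J V →
    ∀ u ∈ V, ∀ v ∈ V, Reach V N u v

section

variable {ι : Type*} {k : ℤ} {J : Finset ι} {V : Finset (ι → ℤ)} {u v : ι → ℤ}

theorem height_not (s : Bool) (i : ι) (x : ι → ℤ) : height k (!s) i x = k - height k s i x := by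
  cases s <;> simp [height]

theorem height_eq_iff {s : Bool} {i : ι} {x y : ι → ℤ} :
    height k s i x = height k s i y ↔ x i = y i := by
  cases s <;> simp [height]

theorem isAffine_height (k : ℤ) (s : Bool) (i : ι) : IsAffine (height k s i) := by
  cases s
  · exact ⟨-Pi.evalAddMonoidHom _ i, k, fun x => by simp [height]; ring⟩
  · exact ⟨Pi.evalAddMonoidHom _ i, 0, fun x => by simp [height]⟩

namespace IsCubeVertexSet

theorem height_nonneg (hV : IsCubeVertexSet k J V) {x : ι → ℤ} (hx : x ∈ V) (s : Bool) (i : ι) :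
    0 ≤ height k s i x := by
  have := hV.cube x hx i
  cases s <;> simp [height] <;> omega

theorem eq_of_height (hV : IsCubeVertexSet k J V) {x y : ι → ℤ} (hx : x ∈ V) (hy : y ∈ V)
    (s : ι → Bool) (h : ∀ i ∈ J, height k (s i) i x = height k (s i) i y) : x = y := by
  ext i
  by_cases hi : i ∈ J
  · exact height_eq_iff.1 (h i hi)
  · exact hV.const x hx y hy i hi

theorem slice [DecidableEq ι] (hV : IsCubeVertexSet k J V) (s : Bool) (i : ι) (m : ℤ) :
    IsCubeVertexSet k (J.erase i) (V.filter fun x => height k s i x = m) where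
  exposed p hp := (hV.exposed p (Finset.mem_filter.1 hp).1).anti (Finset.filter_subset _ _)
  cube x hx := hV.cube x (Finset.mem_filter.1 hx).1
  const x hx y hy j hj := by
    rw [Finset.mem_filter] at hx hy
    by_cases hji : j = i
    · subst hji
      exact height_eq_iff.1 (hx.2.trans hy.2.symm)
    · exact hV.const x hx.1 y hy.1 j fun h => hj (Finset.mem_erase.2 ⟨hji, h⟩)

end IsCubeVertexSet

theorem isFace_filter {c : (ι → ℤ) → ℤ} (hc : IsAffine c) {m : ℤ} (hm : ∀ x ∈ V, m ≤ c x) :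
    IsFace (V.filter fun x => c x = m) V :=
  ⟨c, m, hc, hm, fun _ => Finset.mem_filter⟩

theorem IsCubeVertexSet.exists_reach_wall (hV : IsCubeVertexSet k J V) {s : Bool} {i : ι}
    (hw : ∃ x ∈ V, height k s i x = 0) (hu : u ∈ V) :
    ∃ u' ∈ V, height k s i u' = 0 ∧ Reach V (height k s i u) u u' := by
  simpa using exists_reach_min hV.exposed (isAffine_height k s i)
    (fun x hx => hV.height_nonneg hx s i) hw hu

/-- Two vertices that both lie on the face where a height is minimal. -/
theorem IsCubeVertexSet.reach_of_min [DecidableEq ι] (hV : IsCubeVertexSet k J V) {n : ℕ} {N : ℤ}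
    (hN : DiamBound ι k n N) (hJ : J.card = n + 1) {s : Bool} {i : ι} (hi : i ∈ J) {m : ℤ}
    (hm : ∀ x ∈ V, m ≤ height k s i x) (hu : u ∈ V) (hv : v ∈ V) (hum : height k s i u = m)
    (hvm : height k s i v = m) : Reach V N u v :=
  (hN (J.erase i) _ (by rw [Finset.card_erase_of_mem hi, hJ]; rfl) (hV.slice s i m) u
    (Finset.mem_filter.2 ⟨hu, hum⟩) v (Finset.mem_filter.2 ⟨hv, hvm⟩)).of_face
    (isFace_filter (isAffine_height k s i) hm)

/-- Two vertices are joined through the face on which a height attains its minimum `m`. -/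
theorem IsCubeVertexSet.reach_through [DecidableEq ι] (hV : IsCubeVertexSet k J V) {n : ℕ} {N : ℤ}
    (hN : DiamBound ι k n N) (hJ : J.card = n + 1) {s : Bool} {i : ι} (hi : i ∈ J) {m : ℤ}
    (hm : ∀ x ∈ V, m ≤ height k s i x) (hmin : ∃ x ∈ V, height k s i x = m) (hu : u ∈ V)
    (hv : v ∈ V) : Reach V (height k s i u + height k s i v - 2 * m + N) u v := by
  obtain ⟨u', hu', h1, h2⟩ := exists_reach_min hV.exposed (isAffine_height k s i) hm hmin hu
  obtain ⟨v', hv', h3, h4⟩ := exists_reach_min hV.exposed (isAffine_height k s i) hm hmin hv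
  exact ((h2.trans (hV.reach_of_min hN hJ hi hm hu' hv' h1 h3)).trans h4.symm).mono (by omega)

theorem IsCubeVertexSet.exists_min_height (s : Bool) (i : ι) (hu : u ∈ V) :
    ∃ m, (∀ x ∈ V, m ≤ height k s i x) ∧ ∃ x ∈ V, height k s i x = m := by
  obtain ⟨x, hx, h⟩ := V.exists_min_image (height k s i) ⟨u, hu⟩
  exact ⟨height k s i x, h, x, hx, rfl⟩

/-- `u` and `v` are vertices for which no route through the face of minimal height over a wall is
shorter than the generic estimate. All walls are then touched, `u` and `v` are opposite with
respect to the centre of the cube, and every path to a wall descends by exactly one in each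
step. -/
structure IsFarPair (k : ℤ) (J : Finset ι) (V : Finset (ι → ℤ)) (u v : ι → ℤ) : Prop where
  cvs : IsCubeVertexSet k J V
  left : u ∈ V
  right : v ∈ V
  wall : ∀ i ∈ J, ∀ s, ∃ x ∈ V, height k s i x = 0
  one : ∀ i ∈ J, ∀ s, ∀ y ∈ V, ∀ z ∈ V, ∀ a b, Reach V a u y → Reach V b v z →
    k ≤ a + height k s i y + b + height k s i z

theorem IsFarPair.symm (h : IsFarPair k J V u v) : IsFarPair k J V v u :=
  ⟨h.cvs, h.right, h.left, h.wall, fun i hi s y hy z hz a b ha hb => by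
    have := h.one i hi s z hz y hy b a hb ha; omega⟩

theorem IsFarPair.add (h : IsFarPair k J V u v) {i : ι} (hi : i ∈ J) (s : Bool) :
    height k s i u + height k s i v = k := by
  have h1 := h.one i hi s u h.left v h.right 0 0 (Reach.refl u) (Reach.refl v)
  have h2 := h.one i hi (!s) u h.left v h.right 0 0 (Reach.refl u) (Reach.refl v)
  rw [height_not, height_not] at h2
  omega

theorem IsCubeVertexSet.isFarPair [DecidableEq ι] (hV : IsCubeVertexSet k J V) {n : ℕ} {N : ℤ}
    (hN : DiamBound ι k n N) (hJ : J.card = n + 1) (hu : u ∈ V) (hv : v ∈ V)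
    (hfar : ¬ Reach V (N + k - 1) u v) : IsFarPair k J V u v := by
  have hwall : ∀ i ∈ J, ∀ s, ∃ x ∈ V, height k s i x = 0 := by
    intro i hi s
    obtain ⟨m, hm, x, hx, hxm⟩ := IsCubeVertexSet.exists_min_height (k := k) s i hu
    obtain ⟨m', hm', y, hy, hym⟩ := IsCubeVertexSet.exists_min_height (k := k) (!s) i hu
    have h1 := hV.reach_through hN hJ hi hm ⟨x, hx, hxm⟩ hu hv
    have h2 := hV.reach_through hN hJ hi hm' ⟨y, hy, hym⟩ hu hv
    have h3 := hV.height_nonneg hx s i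
    have h4 := hV.height_nonneg hy (!s) i
    rw [height_not] at h2 h4 hym
    rw [height_not] at h2
    by_contra hcon
    have h5 : m ≠ 0 := fun h => hcon ⟨x, hx, hxm.trans h⟩
    by_cases h6 : height k s i u + height k s i v - 2 * m + N ≤ N + k - 1
    · exact hfar (h1.mono h6)
    · exact hfar (h2.mono (by omega))
  refine ⟨hV, hu, hv, hwall, fun i hi s y hy z hz a b ha hb => ?_⟩
  by_contra hlt
  have h1 := hV.reach_through hN hJ hi (fun x hx => hV.height_nonneg hx s i) (hwall i hi s) hy hz
  exact hfar (((ha.trans h1).trans hb.symm).mono (by omega))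

/-- Routes through the intersection of two walls. -/
theorem IsCubeVertexSet.reach_two [DecidableEq ι] (hV : IsCubeVertexSet k J V) {n : ℕ} {N : ℤ}
    (hN : DiamBound ι k n N) (hJ : J.card = n + 2) {s t : Bool} {i j : ι} (hi : i ∈ J)
    (hj : j ∈ J) (hij : i ≠ j) (hQ : ∃ x ∈ V, height k s i x = 0 ∧ height k t j x = 0)
    (hu : u ∈ V) (hv : v ∈ V) :
    Reach V (height k s i u + height k t j u + (height k s i v + height k t j v) + N) u v := by
  have haff := (isAffine_height k s i).add (isAffine_height k t j)
  have hnn : ∀ x ∈ V, 0 ≤ height k s i x + height k t j x := fun x hx =>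
    add_nonneg (hV.height_nonneg hx s i) (hV.height_nonneg hx t j)
  obtain ⟨x, hx, hx1, hx2⟩ := hQ
  have hmin : ∃ x ∈ V, height k s i x + height k t j x = 0 := ⟨x, hx, by omega⟩
  obtain ⟨u', hu', h1, h2⟩ := exists_reach_min hV.exposed haff hnn hmin hu
  obtain ⟨v', hv', h3, h4⟩ := exists_reach_min hV.exposed haff hnn hmin hv
  have := hV.height_nonneg hu' s i
  have := hV.height_nonneg hu' t j
  have := hV.height_nonneg hv' s i
  have := hV.height_nonneg hv' t j
  have hW := hV.slice s i 0
  have h5 := hW.reach_of_min hN (by rw [Finset.card_erase_of_mem hi, hJ]; rfl)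
    (Finset.mem_erase.2 ⟨hij.symm, hj⟩) (s := t) (m := 0) (u := u') (v := v')
    (fun x hx => hW.height_nonneg hx t j)
    (Finset.mem_filter.2 ⟨hu', by omega⟩) (Finset.mem_filter.2 ⟨hv', by omega⟩)
    (by omega) (by omega)
  have h6 := h5.of_face (isFace_filter (isAffine_height k s i) fun x hx => hV.height_nonneg hx s i)
  exact ((h2.trans h6).trans h4.symm).mono (by omega)

/-- Routes through the intersection of three walls. -/
theorem IsCubeVertexSet.reach_three [DecidableEq ι] (hV : IsCubeVertexSet k J V) {n : ℕ} {N : ℤ}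
    (hN : DiamBound ι k n N) (hJ : J.card = n + 3) {s t r : Bool} {i j l : ι} (hi : i ∈ J)
    (hj : j ∈ J) (hl : l ∈ J) (hij : i ≠ j) (hli : l ≠ i) (hlj : l ≠ j)
    (hQ : ∃ x ∈ V, height k s i x = 0 ∧ height k t j x = 0 ∧ height k r l x = 0)
    (hu : u ∈ V) (hv : v ∈ V) :
    Reach V (height k s i u + height k t j u + height k r l u +
      (height k s i v + height k t j v + height k r l v) + N) u v := by
  have haff := ((isAffine_height k s i).add (isAffine_height k t j)).add (isAffine_height k r l)
  have hnn : ∀ x ∈ V, 0 ≤ height k s i x + height k t j x + height k r l x := fun x hx =>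
    add_nonneg (add_nonneg (hV.height_nonneg hx s i) (hV.height_nonneg hx t j))
      (hV.height_nonneg hx r l)
  obtain ⟨x, hx, hx1, hx2, hx3⟩ := hQ
  have hmin : ∃ x ∈ V, height k s i x + height k t j x + height k r l x = 0 := ⟨x, hx, by omega⟩
  obtain ⟨u', hu', h1, h2⟩ := exists_reach_min hV.exposed haff hnn hmin hu
  obtain ⟨v', hv', h3, h4⟩ := exists_reach_min hV.exposed haff hnn hmin hv
  have := hV.height_nonneg hu' s i
  have := hV.height_nonneg hu' t j
  have := hV.height_nonneg hu' r l
  have := hV.height_nonneg hv' s i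
  have := hV.height_nonneg hv' t j
  have := hV.height_nonneg hv' r l
  have hW := hV.slice s i 0
  have hux : u' ∈ V.filter fun x => height k s i x = 0 := Finset.mem_filter.2 ⟨hu', by omega⟩
  have hvx : v' ∈ V.filter fun x => height k s i x = 0 := Finset.mem_filter.2 ⟨hv', by omega⟩
  have h5 := hW.reach_two hN (by rw [Finset.card_erase_of_mem hi, hJ]; rfl)
    (Finset.mem_erase.2 ⟨hij.symm, hj⟩) (Finset.mem_erase.2 ⟨hli, hl⟩) hlj.symm (s := t)
    (t := r) ⟨u', hux, by omega, by omega⟩ hux hvx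
  have h6 := h5.of_face (isFace_filter (isAffine_height k s i) fun x hx => hV.height_nonneg hx s i)
  exact ((h2.trans h6).trans h4.symm).mono (by omega)

/-- A far pair `u`, `v` for which, in addition, routes through coordinate faces of codimension two
and three save at most one step with respect to the generic estimates `2 * k` and `3 * k`. -/
structure IsVeryFarPair (k : ℤ) (J : Finset ι) (V : Finset (ι → ℤ)) (u v : ι → ℤ) : Prop extends
    IsFarPair k J V u v where
  two : ∀ i ∈ J, ∀ j ∈ J, i ≠ j → ∀ s t,
    (∃ x ∈ V, height k s i x = 0 ∧ height k t j x = 0) → ∀ y ∈ V, ∀ z ∈ V, ∀ a b,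
    Reach V a u y → Reach V b v z →
    2 * k - 1 ≤ a + (height k s i y + height k t j y) + b + (height k s i z + height k t j z)
  -- If two walls do not meet within the polytope, the shorter range of the second height on the
  -- first wall already saves one step, so nothing else may be saved.
  gap : ∀ i ∈ J, ∀ j ∈ J, i ≠ j → ∀ s t,
    (¬ ∃ x ∈ V, height k s i x = 0 ∧ height k t j x = 0) → ∀ y ∈ V, ∀ z ∈ V, ∀ a b,
    height k s i y = 0 → height k s i z = 0 → Reach V a u y → Reach V b v z → a + b ≤ k →
    height k t j y + height k t j z = k + 1 ∧
      ∃ x ∈ V, height k s i x = 0 ∧ height k (!t) j x = 0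
  three : ∀ i ∈ J, ∀ j ∈ J, ∀ l ∈ J, i ≠ j → l ≠ i → l ≠ j → ∀ s t r,
    (∃ x ∈ V, height k s i x = 0 ∧ height k t j x = 0 ∧ height k r l x = 0) →
    ∀ y ∈ V, ∀ z ∈ V, ∀ a b, Reach V a u y → Reach V b v z →
    3 * k - 1 ≤ a + (height k s i y + height k t j y + height k r l y) + b +
      (height k s i z + height k t j z + height k r l z)
  corner : ∀ i ∈ J, ∀ j ∈ J, ∀ l ∈ J, i ≠ j → l ≠ i → l ≠ j → ∀ s t, ∀ y ∈ V, ∀ z ∈ V, ∀ a b,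
    height k s i y = 0 → height k t j y = 0 → height k s i z = 0 → height k t j z = 0 →
    Reach V a u y → Reach V b v z → a + b ≤ 2 * k - 1 → ∀ r,
    ∃ x ∈ V, height k s i x = 0 ∧ height k t j x = 0 ∧ height k r l x = 0

theorem IsVeryFarPair.symm (h : IsVeryFarPair k J V u v) : IsVeryFarPair k J V v u where
  toIsFarPair := h.toIsFarPair.symm
  two i hi j hj hij s t hQ y hy z hz a b ha hb := by
    have := h.two i hi j hj hij s t hQ z hz y hy b a hb ha; omega
  gap i hi j hj hij s t hQ y hy z hz a b hy0 hz0 ha hb hab := by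
    have := h.gap i hi j hj hij s t hQ z hz y hy b a hz0 hy0 hb ha (by omega)
    exact ⟨by omega, this.2⟩
  three i hi j hj l hl hij hli hlj s t r hQ y hy z hz a b ha hb := by
    have := h.three i hi j hj l hl hij hli hlj s t r hQ z hz y hy b a hb ha; omega
  corner i hi j hj l hl hij hli hlj s t y hy z hz a b h1 h2 h3 h4 ha hb hab r :=
    h.corner i hi j hj l hl hij hli hlj s t z hz y hy b a h3 h4 h1 h2 hb ha (by omega) r

theorem IsCubeVertexSet.isVeryFarPair [DecidableEq ι] (hV : IsCubeVertexSet k J V) {n : ℕ}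
    {N N₁ N₂ N₃ : ℤ}
    (hN₁ : DiamBound ι k (n + 2) N₁) (hN₂ : DiamBound ι k (n + 1) N₂) (hN₃ : DiamBound ι k n N₃)
    (hJ : J.card = n + 3) (hu : u ∈ V) (hv : v ∈ V) (h₁ : N₁ + k - 1 ≤ N)
    (h₂ : N₂ + 2 * k - 2 ≤ N) (h₃ : N₃ + 3 * k - 2 ≤ N)
    (hfar : ¬ Reach V N u v) : IsVeryFarPair k J V u v where
  toIsFarPair := hV.isFarPair hN₁ hJ hu hv fun h => hfar (h.mono h₁)
  two i hi j hj hij s t hQ y hy z hz a b ha hb := by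
    by_contra hlt
    have h := hV.reach_two hN₂ hJ hi hj hij hQ hy hz
    exact hfar (((ha.trans h).trans hb.symm).mono (by omega))
  gap i hi j hj hij s t hQ y hy z hz a b hy0 hz0 ha hb hab := by
    have hW := hV.slice s i 0
    have hy' : y ∈ V.filter fun x => height k s i x = 0 := Finset.mem_filter.2 ⟨hy, hy0⟩
    have hz' : z ∈ V.filter fun x => height k s i x = 0 := Finset.mem_filter.2 ⟨hz, hz0⟩
    have hJ' : (J.erase i).card = n + 1 + 1 := by rw [Finset.card_erase_of_mem hi, hJ]; rfl
    have hj' : j ∈ J.erase i := Finset.mem_erase.2 ⟨hij.symm, hj⟩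
    have hface := isFace_filter (isAffine_height k s i)
      fun x (hx : x ∈ V) => hV.height_nonneg hx s i
    obtain ⟨m, hm, x, hx, hxm⟩ := IsCubeVertexSet.exists_min_height (k := k) t j hy'
    obtain ⟨m', hm', x', hx', hxm'⟩ := IsCubeVertexSet.exists_min_height (k := k) (!t) j hy'
    have h1 := (hW.reach_through hN₂ hJ' hj' hm ⟨x, hx, hxm⟩ hy' hz').of_face hface
    have h2 := (hW.reach_through hN₂ hJ' hj' hm' ⟨x', hx', hxm'⟩ hy' hz').of_face hface
    have h3 := hW.height_nonneg hx t j
    have h4 := hW.height_nonneg hx' (!t) j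
    have h5 : height k t j x ≠ 0 := fun h =>
      hQ ⟨x, (Finset.mem_filter.1 hx).1, (Finset.mem_filter.1 hx).2, h⟩
    rw [height_not, height_not] at h2
    have h6 : 2 * k - 1 ≤ a + (height k t j y + height k t j z - 2 * m) + b := by
      by_contra hlt
      exact hfar (((ha.trans h1).trans hb.symm).mono (by omega))
    have h7 : 2 * k - 1 ≤ a + (k - height k t j y + (k - height k t j z) - 2 * m') + b := by
      by_contra hlt
      exact hfar (((ha.trans h2).trans hb.symm).mono (by omega))
    exact ⟨by omega, x', (Finset.mem_filter.1 hx').1, (Finset.mem_filter.1 hx').2, by omega⟩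
  three i hi j hj l hl hij hli hlj s t r hQ y hy z hz a b ha hb := by
    by_contra hlt
    have h := hV.reach_three hN₃ hJ hi hj hl hij hli hlj hQ hy hz
    exact hfar (((ha.trans h).trans hb.symm).mono (by omega))
  corner i hi j hj l hl hij hli hlj s t y hy z hz a b h1 h2 h3 h4 ha hb hab r := by
    have hW := hV.slice s i 0
    have hface := isFace_filter (isAffine_height k s i)
      fun x (hx : x ∈ V) => hV.height_nonneg hx s i
    have hX := hW.slice t j 0
    have hface' := isFace_filter (isAffine_height k t j)
      fun x (hx : x ∈ V.filter fun x => height k s i x = 0) => hW.height_nonneg hx t j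
    have hfp := hX.isFarPair hN₃ (u := y) (v := z)
      (by rw [Finset.card_erase_of_mem (Finset.mem_erase.2 ⟨hij.symm, hj⟩),
        Finset.card_erase_of_mem hi, hJ]; rfl)
      (Finset.mem_filter.2 ⟨Finset.mem_filter.2 ⟨hy, h1⟩, h2⟩)
      (Finset.mem_filter.2 ⟨Finset.mem_filter.2 ⟨hz, h3⟩, h4⟩)
      fun h => hfar (((ha.trans ((h.of_face hface').of_face hface)).trans hb.symm).mono (by omega))
    obtain ⟨x, hx, hx0⟩ := hfp.wall l
      (Finset.mem_erase.2 ⟨hlj, Finset.mem_erase.2 ⟨hli, hl⟩⟩) r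
    rw [Finset.mem_filter, Finset.mem_filter] at hx
    exact ⟨x, hx.1.1, hx.1.2, hx.2, hx0⟩

end

/-! ### Planar arguments -/

section

variable {ι : Type*} {k : ℤ} {J : Finset ι} {V : Finset (ι → ℤ)} {u v : ι → ℤ}

theorem exists_height_sub (k : ℤ) (s : Bool) (i : ι) :
    ∃ ε : ℤ, ∀ x y : ι → ℤ, x i - y i = ε * (height k s i x - height k s i y) := by
  cases s
  · exact ⟨-1, fun x y => by simp [height]⟩
  · exact ⟨1, fun x y => by simp [height]⟩

/-- A vertex is not a convex combination of two other vertices, in a plane spanned by two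
coordinate directions. -/
theorem IsCubeVertexSet.eq_of_combination (hV : IsCubeVertexSet k J V) {i j : ι} (s t : Bool)
    {p x y : ι → ℤ} (hp : p ∈ V) (hx : x ∈ V) (hy : y ∈ V)
    (hxp : ∀ l ∈ J, l ≠ i → l ≠ j → x l = p l) (hyp : ∀ l ∈ J, l ≠ i → l ≠ j → y l = p l)
    (α β : ℤ) (hα : 0 < α) (hβ : 0 ≤ β)
    (hi : α * height k s i x + β * height k s i y = (α + β) * height k s i p)
    (hj : α * height k t j x + β * height k t j y = (α + β) * height k t j p) : x = p := by
  refine (hV.exposed p hp).eq_of_combination hx hy hα hβ ?_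
  ext l
  simp only [Pi.add_apply, Pi.smul_apply, smul_eq_mul]
  by_cases hl : l ∈ J
  · by_cases hli : l = i
    · subst hli
      obtain ⟨ε, hε⟩ := exists_height_sub k s l
      linear_combination α * hε x p + β * hε y p + ε * hi
    by_cases hlj : l = j
    · subst hlj
      obtain ⟨ε, hε⟩ := exists_height_sub k t l
      linear_combination α * hε x p + β * hε y p + ε * hj
    · rw [hxp l hl hli hlj, hyp l hl hli hlj]
      ring
  · rw [hV.const x hx p hp l hl, hV.const y hy p hp l hl]
    ring

/-- The line through an edge does not separate two vertices in a plane spanned by two coordinate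
directions. The side of the line is given by the sign of a determinant. -/
theorem IsCubeVertexSet.not_separated (hV : IsCubeVertexSet k J V) {i j : ι} (s t : Bool)
    {y z p q : ι → ℤ} (hyz : (edgeGraph V).Adj y z) (hp : p ∈ V) (hq : q ∈ V)
    (hzy : ∀ l ∈ J, l ≠ i → l ≠ j → z l = y l) (hpy : ∀ l ∈ J, l ≠ i → l ≠ j → p l = y l)
    (hqy : ∀ l ∈ J, l ≠ i → l ≠ j → q l = y l)
    (h1 : 0 < (height k s i z - height k s i y) * (height k t j p - height k t j y) -
      (height k t j z - height k t j y) * (height k s i p - height k s i y))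
    (h2 : (height k s i z - height k s i y) * (height k t j q - height k t j y) -
      (height k t j z - height k t j y) * (height k s i q - height k s i y) < 0) : False := by
  obtain ⟨-, hy, hz, φ, hφ, hφ'⟩ := hyz
  set A := (height k s i z - height k s i y) * (height k t j p - height k t j y) -
      (height k t j z - height k t j y) * (height k s i p - height k s i y) with hA
  set B := (height k s i z - height k s i y) * (height k t j q - height k t j y) -
      (height k t j z - height k t j y) * (height k s i q - height k s i y) with hB
  have hφp : φ y < φ p := hφ' p hp (fun h => by simp [hA, h] at h1)
    (fun h => by rw [hA, h] at h1; linarith)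
  have hφq : φ y < φ q := hφ' q hq (fun h => by simp [hB, h] at h2)
    (fun h => by rw [hB, h] at h2; linarith)
  set e := height k s i z - height k s i y
  set f := height k t j z - height k t j y
  set m := -B * (height k s i p - height k s i y) + A * (height k s i q - height k s i y)
  set n := -B * (height k t j p - height k t j y) + A * (height k t j q - height k t j y)
  -- The weights `-B` and `A` put the combination of `p` and `q` on the line through `y` and `z`.
  have hvec : (e ^ 2 + f ^ 2) • (-B • (p - y) + A • (q - y)) = (e * m + f * n) • (z - y) := by
    ext l
    simp only [Pi.add_apply, Pi.smul_apply, Pi.sub_apply, smul_eq_mul]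
    by_cases hl : l ∈ J
    · by_cases hli : l = i
      · subst hli
        obtain ⟨ε, hε⟩ := exists_height_sub k s l
        rw [hε, hε q, hε z, hA, hB]
        ring
      by_cases hlj : l = j
      · subst hlj
        obtain ⟨ε, hε⟩ := exists_height_sub k t l
        rw [hε, hε q, hε z, hA, hB]
        ring
      · rw [hzy l hl hli hlj, hpy l hl hli hlj, hqy l hl hli hlj]
        ring
    · rw [hV.const p hp y hy l hl, hV.const q hq y hy l hl, hV.const z hz y hy l hl]
      ring
  have hN : 0 < e ^ 2 + f ^ 2 := by
    rcases eq_or_ne e 0 with h | h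
    · rcases eq_or_ne f 0 with h' | h'
      · rw [hA, h, h'] at h1
        simp at h1
      · positivity
    · positivity
  have h3 := congrArg φ hvec
  rw [map_zsmul, map_zsmul, map_add, map_zsmul, map_zsmul, map_sub, map_sub, map_sub, hφ,
    sub_self, smul_zero] at h3
  simp only [zsmul_eq_mul] at h3
  have h4 : (0 : ℝ) < ((e ^ 2 + f ^ 2 : ℤ) : ℝ) := by exact_mod_cast hN
  have h5 : (0 : ℝ) < ((-B : ℤ) : ℝ) := by exact_mod_cast (by omega : 0 < -B)
  have h6 : (0 : ℝ) < (A : ℝ) := by exact_mod_cast h1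
  have h7 := mul_pos h5 (sub_pos.2 hφp)
  have h8 := mul_pos h6 (sub_pos.2 hφq)
  rw [hφ] at h7 h8
  have h9 := mul_pos h4 (add_pos h7 h8)
  linarith

/-! ### Paths that save one step -/

theorem IsFarPair.exists_reach_two (h : IsFarPair k J V u v) {i j : ι} {s t : Bool}
    (hQ : ∃ x ∈ V, height k s i x = 0 ∧ height k t j x = 0) {x : ι → ℤ} (hx : x ∈ V) :
    ∃ x' ∈ V, height k s i x' = 0 ∧ height k t j x' = 0 ∧
      Reach V (height k s i x + height k t j x) x x' := by
  obtain ⟨y, hy, hy1, hy2⟩ := hQ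
  obtain ⟨x', hx', h1, h2⟩ := exists_reach_min h.cvs.exposed
    ((isAffine_height k s i).add (isAffine_height k t j)) (m := 0)
    (fun x hx => add_nonneg (h.cvs.height_nonneg hx s i) (h.cvs.height_nonneg hx t j))
    ⟨y, hy, by omega⟩ hx
  have := h.cvs.height_nonneg hx' s i
  have := h.cvs.height_nonneg hx' t j
  exact ⟨x', hx', by omega, by omega, by simpa using h2⟩

namespace IsVeryFarPair

/-- If one step has been saved on the way to the intersection of two walls, then all further
steps towards it lower the sum of the two heights by exactly one and fix all other coordinates,
since anything else would save a second step on the way to three walls. -/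
theorem exists_step (h : IsVeryFarPair k J V u v) {i j : ι} (hi : i ∈ J) (hj : j ∈ J)
    (hij : i ≠ j) {s t : Bool} (hQ : ∃ x ∈ V, height k s i x = 0 ∧ height k t j x = 0)
    (hcorner : ∀ l ∈ J, l ≠ i → l ≠ j → ∀ r, ∃ x ∈ V, height k s i x = 0 ∧ height k t j x = 0 ∧
      height k r l x = 0) {y z : ι → ℤ} (hy : y ∈ V) (hz : z ∈ V) {a b : ℤ} (ha : Reach V a u y)
    (hb : Reach V b v z) (hab : a + (height k s i y + height k t j y) + b +
      (height k s i z + height k t j z) = 2 * k - 1)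
    (hzv : ∀ l ∈ J, l ≠ i → l ≠ j → z l = v l) (hpos : 0 < height k s i y + height k t j y) :
    ∃ y', (edgeGraph V).Adj y y' ∧
      height k s i y' + height k t j y' = height k s i y + height k t j y - 1 ∧
      ∀ l ∈ J, l ≠ i → l ≠ j → y' l = u l := by
  obtain ⟨x, hx, hx1, hx2⟩ := hQ
  obtain ⟨y', hyy', hlt⟩ := exists_adj_lt h.cvs.exposed
    ((isAffine_height k s i).add (isAffine_height k t j)) hy hx (by rw [hx1, hx2]; exact hpos)
  have hy' := hyy'.2.2.1
  have hr := ha.trans (Reach.of_adj hyy')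
  have h1 := h.two i hi j hj hij s t ⟨x, hx, hx1, hx2⟩ y' hy' z hz _ _ hr hb
  refine ⟨y', hyy', by omega, fun l hl hli hlj => ?_⟩
  have h2 := h.three i hi j hj l hl hij hli hlj s t true (hcorner l hl hli hlj _) y' hy' z hz _ _
    hr hb
  have h3 := h.three i hi j hj l hl hij hli hlj s t (!true) (hcorner l hl hli hlj _) y' hy' z hz
    _ _ hr hb
  have h4 := h.add hl true
  rw [height_not, height_not] at h3
  have h5 : height k true l z = height k true l v := height_eq_iff.2 (hzv l hl hli hlj)
  exact height_eq_iff.1 (by omega : height k true l y' = height k true l u)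

/-- The case of `heights_le_one` in which the first step of the descent, from `u` to `y`, is
parallel to direction `i`. Here `o` is the point with the other coordinates of `u` on both walls,
and the path from `v` to `z` has saved a step. If the heights of `u` were larger, the edge from `y`
to the next vertex would separate `u` from `o`, or some vertex would lie between two others. -/
theorem heights_le_one_of_adj (h : IsVeryFarPair k J V u v) {i j : ι} (hi : i ∈ J) (hj : j ∈ J)
    (hij : i ≠ j) {s t : Bool}
    (hcorner : ∀ l ∈ J, l ≠ i → l ≠ j → ∀ r, ∃ x ∈ V, height k s i x = 0 ∧ height k t j x = 0 ∧
      height k r l x = 0) {o y z : ι → ℤ} (ho : o ∈ V) (hoi : height k s i o = 0)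
    (hoj : height k t j o = 0) (hou : ∀ l ∈ J, l ≠ i → l ≠ j → o l = u l) (hz : z ∈ V) {b : ℤ}
    (hb : Reach V b v z) (hub : height k s i u + height k t j u + b +
      (height k s i z + height k t j z) = 2 * k - 1)
    (hzv : ∀ l ∈ J, l ≠ i → l ≠ j → z l = v l) (huy : (edgeGraph V).Adj u y)
    (hyu : ∀ l ∈ J, l ≠ i → l ≠ j → y l = u l) (hyi : height k s i y = height k s i u - 1)
    (hyj : height k t j y = height k t j u) : height k s i u ≤ 1 ∧ height k t j u ≤ 1 := by
  have hy := huy.2.2.1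
  have hyi0 := h.cvs.height_nonneg hy s i
  have hyj0 := h.cvs.height_nonneg hy t j
  by_cases h0 : height k s i y + height k t j y = 0
  · omega
  obtain ⟨y', hyy', hsum, hy'u⟩ := h.exists_step hi hj hij ⟨o, ho, hoi, hoj⟩ hcorner hy hz
    (Reach.of_adj huy) hb (by omega) hzv (by omega)
  have hy' := hyy'.2.2.1
  have hr := (Reach.of_adj huy).trans (Reach.of_adj hyy')
  have h1 := h.one i hi s y' hy' v h.right _ _ hr (Reach.refl v)
  have h2 := h.one j hj t y' hy' v h.right _ _ hr (Reach.refl v)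
  have h3 := h.add hi s
  have h4 := h.add hj t
  have h5 := h.cvs.height_nonneg hy' s i
  have h6 := h.cvs.height_nonneg hy' t j
  have e1 : ∀ l ∈ J, l ≠ i → l ≠ j → u l = y l := fun l a b c => (hyu l a b c).symm
  have e2 : ∀ l ∈ J, l ≠ i → l ≠ j → o l = y l := fun l a b c =>
    (hou l a b c).trans (hyu l a b c).symm
  have e3 : ∀ l ∈ J, l ≠ i → l ≠ j → y' l = y l := fun l a b c =>
    (hy'u l a b c).trans (hyu l a b c).symm
  obtain h7 | h7 | h7 : height k s i y' = height k s i u - 2 ∨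
      height k s i y' = height k s i u - 1 ∨ height k s i y' = height k s i u := by omega
  · exact absurd (h.cvs.eq_of_combination s t hy h.left hy' e1 e3 1 1 (by omega) (by omega)
      (by omega) (by omega)) huy.1
  · by_cases h8 : height k s i u ≤ 1
    · refine ⟨h8, ?_⟩
      by_contra h9
      refine hyy'.1 (h.cvs.eq_of_combination s t hy' hy ho (fun l a b c => (e3 l a b c).symm)
        (fun l a b c => (hou l a b c).trans (hy'u l a b c).symm) (height k t j u - 1) 1 (by omega)
        (by omega) ?_ ?_)
      · rw [hoi, show height k s i y = 0 by omega, show height k s i y' = 0 by omega]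
        ring
      · rw [hoj, hyj, show height k t j y' = height k t j u - 1 by omega]
        ring
    · refine (h.cvs.not_separated s t hyy' h.left ho e3 e1 e2 ?_ ?_).elim
      · rw [h7, hyi, hyj, show height k t j y' = height k t j u - 1 by omega]
        ring_nf
        omega
      · rw [h7, hyi, hyj, show height k t j y' = height k t j u - 1 by omega, hoi, hoj]
        ring_nf
        omega
  · refine (h.cvs.not_separated s t hyy' h.left ho e3 e1 e2 ?_ ?_).elim
    · rw [h7, hyi, hyj, show height k t j y' = height k t j u - 2 by omega]
      ring_nf
      omega
    · rw [h7, hyi, hyj, show height k t j y' = height k t j u - 2 by omega, hoi, hoj]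
      ring_nf
      omega

/-- If `u` reaches a vertex `o` on two walls while saving a step, then `o` differs from `u` only
in the two directions orthogonal to these walls. -/
theorem saving_path (h : IsVeryFarPair k J V u v) {i j : ι} (hi : i ∈ J) (hj : j ∈ J)
    (hij : i ≠ j) {s t : Bool} {o : ι → ℤ} (ho : o ∈ V) (hoi : height k s i o = 0)
    (hoj : height k t j o = 0) (hr : Reach V (height k s i u + height k t j u - 1) u o) {l : ι}
    (hl : l ∈ J) (hli : l ≠ i) (hlj : l ≠ j) :
    o l = u l ∧ ∀ r, ∃ x ∈ V, height k s i x = 0 ∧ height k t j x = 0 ∧ height k r l x = 0 := by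
  obtain ⟨v', hv', h1, h2, h3⟩ := h.toIsFarPair.exists_reach_two ⟨o, ho, hoi, hoj⟩ h.right
  have hai := h.add hi s
  have haj := h.add hj t
  have hal := h.add hl true
  have hc := h.corner i hi j hj l hl hij hli hlj s t o ho v' hv' _ _ hoi hoj h1 h2 hr h3
    (by omega)
  have h4 := h.three i hi j hj l hl hij hli hlj s t true (hc _) o ho v h.right _ _ hr
    (Reach.refl v)
  have h5 := h.three i hi j hj l hl hij hli hlj s t (!true) (hc _) o ho v h.right _ _ hr
    (Reach.refl v)
  rw [height_not, height_not] at h5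
  exact ⟨height_eq_iff.1 (by omega : height k true l o = height k true l u), hc⟩

/-- If `u` reaches the intersection of two walls while saving a step, then `v` has height at most
one above both walls: the descent of `v` is a convex lattice chain in a plane, along which the sum
of the two heights drops by exactly one in each step. -/
theorem heights_le_one (h : IsVeryFarPair k J V u v) {i j : ι} (hi : i ∈ J) (hj : j ∈ J)
    (hij : i ≠ j) {s t : Bool} {o : ι → ℤ} (ho : o ∈ V) (hoi : height k s i o = 0)
    (hoj : height k t j o = 0) (hr : Reach V (height k s i u + height k t j u - 1) u o) :
    height k s i v ≤ 1 ∧ height k t j v ≤ 1 := by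
  have hsave := fun l hl hli hlj => h.saving_path hi hj hij ho hoi hoj hr (l := l) hl hli hlj
  obtain ⟨v', hv', h1, h2, h3⟩ := h.toIsFarPair.exists_reach_two ⟨o, ho, hoi, hoj⟩ h.right
  have hai := h.add hi s
  have haj := h.add hj t
  have hvi := h.cvs.height_nonneg h.right s i
  have hvj := h.cvs.height_nonneg h.right t j
  have hv'v : ∀ l ∈ J, l ≠ i → l ≠ j → v' l = v l := by
    intro l hl hli hlj
    obtain ⟨hol, hc⟩ := hsave l hl hli hlj
    have h4 := h.three i hi j hj l hl hij hli hlj s t true (hc _) o ho v' hv' _ _ hr h3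
    have h5 := h.three i hi j hj l hl hij hli hlj s t (!true) (hc _) o ho v' hv' _ _ hr h3
    have h6 : height k true l o = height k true l u := height_eq_iff.2 hol
    have hal := h.add hl true
    rw [height_not, height_not] at h5
    exact height_eq_iff.1 (by omega : height k true l v' = height k true l v)
  by_cases h0 : height k s i v + height k t j v = 0
  · omega
  have hcorner := fun l hl hli hlj => (hsave l hl hli hlj).2
  have hou := fun l hl hli hlj => (hsave l hl hli hlj).1
  obtain ⟨y, hvy, hsum, hyv⟩ := h.symm.exists_step hi hj hij ⟨o, ho, hoi, hoj⟩ hcorner h.right ho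
    (Reach.refl v) hr (by omega) hou (by omega)
  have h7 := h.symm.one i hi s y hvy.2.2.1 u h.left _ _ (Reach.of_adj hvy) (Reach.refl u)
  have h8 := h.symm.one j hj t y hvy.2.2.1 u h.left _ _ (Reach.of_adj hvy) (Reach.refl u)
  by_cases h9 : height k s i y = height k s i v
  · refine (h.symm.heights_le_one_of_adj hj hi hij.symm (s := t) (t := s)
      (fun l hl hlj hli r => ?_) hv' h2 h1 (fun l hl hlj hli => hv'v l hl hli hlj) ho hr
      (by omega) (fun l hl hlj hli => hou l hl hli hlj) hvy
      (fun l hl hlj hli => hyv l hl hli hlj) (by omega) h9).symm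
    obtain ⟨x, hx, hx1, hx2, hx3⟩ := hcorner l hl hli hlj r
    exact ⟨x, hx, hx2, hx1, hx3⟩
  · exact h.symm.heights_le_one_of_adj hi hj hij hcorner hv' h1 h2 hv'v ho hr (by omega) hou hvy
      hyv (by omega) (by omega)

/-! ### Neighbours differ in one coordinate -/

/-- No edge at `u` descends towards two walls at once if these meet within the polytope. Such an
edge saves a step, so `v` is close to both walls and `u` is far from them, and the step that
follows this edge has nowhere to go. -/
theorem not_double_of_meet (h : IsVeryFarPair k J V u v) (hk : 3 ≤ k) {i j : ι} (hi : i ∈ J)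
    (hj : j ∈ J) (hij : i ≠ j) {s t : Bool}
    (hQ : ∃ x ∈ V, height k s i x = 0 ∧ height k t j x = 0) {w : ι → ℤ}
    (huw : (edgeGraph V).Adj u w) (hwi : height k s i w = height k s i u - 1)
    (hwj : height k t j w = height k t j u - 1) : False := by
  have hw := huw.2.2.1
  obtain ⟨o, ho, hoi, hoj, hwo⟩ := h.toIsFarPair.exists_reach_two hQ hw
  have hr : Reach V (height k s i u + height k t j u - 1) u o :=
    ((Reach.of_adj huw).trans hwo).mono (by omega)
  have hsave := fun l hl hli hlj => h.saving_path hi hj hij ho hoi hoj hr (l := l) hl hli hlj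
  obtain ⟨h1, h2⟩ := h.heights_le_one hi hj hij ho hoi hoj hr
  have hai := h.add hi s
  have haj := h.add hj t
  have hwu : ∀ l ∈ J, l ≠ i → l ≠ j → w l = u l := by
    intro l hl hli hlj
    obtain ⟨-, hc⟩ := hsave l hl hli hlj
    have h4 := h.three i hi j hj l hl hij hli hlj s t true (hc _) w hw v h.right _ _
      (Reach.of_adj huw) (Reach.refl v)
    have h5 := h.three i hi j hj l hl hij hli hlj s t (!true) (hc _) w hw v h.right _ _
      (Reach.of_adj huw) (Reach.refl v)
    have hal := h.add hl true
    rw [height_not, height_not] at h5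
    exact height_eq_iff.1 (by omega : height k true l w = height k true l u)
  obtain ⟨y, hwy, hsum, hyu⟩ := h.exists_step hi hj hij hQ
    (fun l hl hli hlj => (hsave l hl hli hlj).2) hw h.right (Reach.of_adj huw) (Reach.refl v)
    (by omega) (fun _ _ _ _ => rfl) (by omega)
  have hr2 := (Reach.of_adj huw).trans (Reach.of_adj hwy)
  have h7 := h.one i hi s y hwy.2.2.1 v h.right _ _ hr2 (Reach.refl v)
  have h8 := h.one j hj t y hwy.2.2.1 v h.right _ _ hr2 (Reach.refl v)
  have e1 : ∀ l ∈ J, l ≠ i → l ≠ j → u l = w l := fun l a b c => (hwu l a b c).symm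
  have e2 : ∀ l ∈ J, l ≠ i → l ≠ j → o l = w l := fun l a b c =>
    (hsave l a b c).1.trans (e1 l a b c)
  have e3 : ∀ l ∈ J, l ≠ i → l ≠ j → y l = w l := fun l a b c =>
    (hyu l a b c).trans (e1 l a b c)
  -- The edge from `w` to `y` is parallel to an axis, and it separates `u` from `o`.
  by_cases h9 : height k s i y = height k s i w
  · refine h.cvs.not_separated s t hwy h.left ho e3 e1 e2 ?_ ?_
    · rw [h9, show height k t j y = height k t j w - 1 by omega, hwi]
      ring_nf
      omega
    · rw [h9, show height k t j y = height k t j w - 1 by omega, hwi, hoi]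
      ring_nf
      omega
  · refine h.cvs.not_separated s t hwy ho h.left e3 e2 e1 ?_ ?_
    · rw [show height k s i y = height k s i w - 1 by omega,
        show height k t j y = height k t j w by omega, hwj, hoj]
      ring_nf
      omega
    · rw [show height k s i y = height k s i w - 1 by omega,
        show height k t j y = height k t j w by omega, hwj]
      ring_nf
      omega

/-- If two walls do not meet within the polytope, no edge at `u` descends towards both and ends on
the first of them. -/
theorem not_double_of_wall (h : IsVeryFarPair k J V u v) {i j : ι} (hi : i ∈ J)
    (hj : j ∈ J) (hij : i ≠ j) {s t : Bool}
    (hQ : ¬ ∃ x ∈ V, height k s i x = 0 ∧ height k t j x = 0) {w : ι → ℤ}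
    (huw : (edgeGraph V).Adj u w) (hwi : height k s i w = height k s i u - 1)
    (hwj : height k t j w = height k t j u - 1) (hw0 : height k s i w = 0) : False := by
  obtain ⟨v', hv', h1, h2⟩ := h.cvs.exists_reach_wall (h.wall i hi s) h.right
  have hai := h.add hi s
  have haj := h.add hj t
  obtain ⟨h3, h4⟩ := h.gap i hi j hj hij s t hQ w huw.2.2.1 v' hv' _ _ hw0 h1
    (Reach.of_adj huw) h2 (by omega)
  have h5 := h.two i hi j hj hij s (!t) h4 u h.left v' hv' _ _ (Reach.refl u) h2
  rw [height_not, height_not] at h5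
  omega

/-- No edge at `u` descends towards two walls at once if these do not meet within the polytope. -/
theorem not_double_of_disjoint (h : IsVeryFarPair k J V u v) {i j : ι} (hi : i ∈ J)
    (hj : j ∈ J) (hij : i ≠ j) {s t : Bool}
    (hQ : ¬ ∃ x ∈ V, height k s i x = 0 ∧ height k t j x = 0) {w : ι → ℤ}
    (huw : (edgeGraph V).Adj u w) (hwi : height k s i w = height k s i u - 1)
    (hwj : height k t j w = height k t j u - 1) : False := by
  obtain ⟨u', hu', h1, h2⟩ := h.cvs.exists_reach_wall (h.wall i hi s) h.left
  obtain ⟨v', hv', h3, h4⟩ := h.cvs.exists_reach_wall (h.wall i hi s) h.right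
  have hai := h.add hi s
  have haj := h.add hj t
  have hwi0 := h.cvs.height_nonneg huw.2.2.1 s i
  have hwj0 := h.cvs.height_nonneg huw.2.2.1 t j
  obtain ⟨h5, hQ'⟩ := h.gap i hi j hj hij s t hQ u' hu' v' hv' _ _ h1 h3 h2 h4 (by omega)
  -- One of the two paths to the first wall has gained height above the second wall, hence saves
  -- a step on the way to the intersection of the first wall with the wall opposite to the second.
  by_cases h6 : height k t j u < height k t j u'
  · obtain ⟨o, ho, hoi, hoj, hr⟩ := h.toIsFarPair.exists_reach_two hQ' hu'
    have h7 := h.heights_le_one hi hj hij ho hoi hoj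
      ((h2.trans hr).mono (by rw [height_not, height_not]; omega))
    rw [height_not] at h7
    refine h.not_double_of_wall hj hi hij.symm ?_ huw hwj hwi (by omega)
    rintro ⟨x, hx, hx1, hx2⟩
    exact hQ ⟨x, hx, hx2, hx1⟩
  · obtain ⟨o, ho, hoi, hoj, hr⟩ := h.toIsFarPair.exists_reach_two hQ' hv'
    have h7 := h.symm.heights_le_one hi hj hij ho hoi hoj
      ((h4.trans hr).mono (by rw [height_not, height_not]; omega))
    exact h.not_double_of_wall hi hj hij hQ huw hwi hwj (by omega)

end IsVeryFarPair

theorem IsFarPair.exists_height_sub_one (h : IsFarPair k J V u v) {i : ι} (hi : i ∈ J)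
    {w : ι → ℤ} (huw : (edgeGraph V).Adj u w) (hne : w i ≠ u i) :
    ∃ s, height k s i w = height k s i u - 1 := by
  have h1 := h.one i hi true w huw.2.2.1 v h.right _ _ (Reach.of_adj huw) (Reach.refl v)
  have h2 := h.one i hi (!true) w huw.2.2.1 v h.right _ _ (Reach.of_adj huw) (Reach.refl v)
  have h3 := h.add hi true
  rw [height_not, height_not] at h2
  have h4 : height k true i w ≠ height k true i u := fun h => hne (height_eq_iff.1 h)
  by_cases h5 : height k true i w = height k true i u - 1
  · exact ⟨true, h5⟩
  · exact ⟨!true, by rw [height_not, height_not]; omega⟩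

/-- All edges at `u` are parallel to coordinate axes. -/
theorem IsVeryFarPair.not_double (h : IsVeryFarPair k J V u v) (hk : 3 ≤ k) {i j : ι} (hi : i ∈ J)
    (hj : j ∈ J) (hij : i ≠ j) {w : ι → ℤ} (huw : (edgeGraph V).Adj u w) (hwi : w i ≠ u i) :
    w j = u j := by
  by_contra hwj
  obtain ⟨s, hs⟩ := h.exists_height_sub_one hi huw hwi
  obtain ⟨t, ht⟩ := h.exists_height_sub_one hj huw hwj
  by_cases hQ : ∃ x ∈ V, height k s i x = 0 ∧ height k t j x = 0
  · exact h.not_double_of_meet hk hi hj hij hQ huw hs ht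
  · exact h.not_double_of_disjoint hi hj hij hQ huw hs ht

end

/-! ### Pairs of opposite corners of the cube -/

section

variable {ι : Type*} {k : ℤ} {J : Finset ι} {V : Finset (ι → ℤ)} {u v : ι → ℤ}

theorem IsFarPair.exists_adj_height (h : IsFarPair k J V u v) {i : ι} (hi : i ∈ J) {s : Bool}
    (hpos : 0 < height k s i u) :
    ∃ w, (edgeGraph V).Adj u w ∧ height k s i w = height k s i u - 1 := by
  obtain ⟨x, hx, hx0⟩ := h.wall i hi s
  obtain ⟨w, hw, hlt⟩ := exists_adj_lt h.cvs.exposed (isAffine_height k s i) h.left hx (by omega)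
  have h1 := h.one i hi s w hw.2.2.1 v h.right _ _ (Reach.of_adj hw) (Reach.refl v)
  have h2 := h.add hi s
  exact ⟨w, hw, by omega⟩

/-- If all edges at `u` are parallel to coordinate axes, then `u` is a corner of the cube, since
otherwise `u` would be the midpoint of two neighbours. -/
theorem IsFarPair.exists_height_eq_zero (h : IsFarPair k J V u v)
    (hsingle : ∀ w, (edgeGraph V).Adj u w → ∀ i ∈ J, ∀ j ∈ J, i ≠ j → w i ≠ u i → w j = u j)
    {i : ι} (hi : i ∈ J) : ∃ s, height k s i u = 0 := by
  by_contra hcon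
  push Not at hcon
  have h1 := h.cvs.height_nonneg h.left true i
  have h2 := h.cvs.height_nonneg h.left (!true) i
  have h3 := hcon true
  have h4 := hcon (!true)
  obtain ⟨w, hw, hws⟩ := h.exists_adj_height hi (s := true) (by omega)
  obtain ⟨w', hw', hws'⟩ := h.exists_adj_height hi (s := !true) (by omega)
  rw [height_not, height_not] at hws'
  have hne : w i ≠ u i := fun h => by
    have := (height_eq_iff (k := k) (s := true)).2 h
    omega
  have hne' : w' i ≠ u i := fun h => by
    have := (height_eq_iff (k := k) (s := true)).2 h
    omega
  refine hw.1 (h.cvs.eq_of_combination (i := i) (j := i) true true h.left hw.2.2.1 hw'.2.2.1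
    (fun l hl hli _ => hsingle w hw i hi l hl hli.symm hne)
    (fun l hl hli _ => hsingle w' hw' i hi l hl hli.symm hne') 1 1 (by omega) (by omega)
    (by omega) (by omega)).symm

/-- The polytope does not contain a whole edge of the cube issuing from `u`. -/
theorem IsFarPair.not_cube_edge (h : IsFarPair k J V u v) (hk : 2 ≤ k)
    (hsingle : ∀ w, (edgeGraph V).Adj u w → ∀ i ∈ J, ∀ j ∈ J, i ≠ j → w i ≠ u i → w j = u j)
    {i : ι} (hi : i ∈ J) {s : Bool} (hu : height k s i u = 0) {x : ι → ℤ} (hx : x ∈ V)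
    (hxi : height k (!s) i x = 0) (hxu : ∀ l ∈ J, l ≠ i → x l = u l) : False := by
  obtain ⟨w, hw, hwi⟩ := h.exists_adj_height hi (s := !s) (by rw [height_not]; omega)
  rw [height_not, height_not] at hwi
  rw [height_not] at hxi
  have hne : w i ≠ u i := fun h => by
    have := (height_eq_iff (k := k) (s := s)).2 h
    omega
  have hwu : ∀ l ∈ J, l ≠ i → w l = u l := fun l hl hli =>
    hsingle w hw i hi l hl hli.symm hne
  have hcomb : 1 * height k s i x + (k - 1) * height k s i u =
      (1 + (k - 1)) * height k s i w := by
    rw [hu, show height k s i x = k by omega, show height k s i w = 1 by omega]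
    ring
  have := h.cvs.eq_of_combination (i := i) (j := i) s s hw.2.2.1 hx h.left
    (fun l hl hli _ => (hxu l hl hli).trans (hwu l hl hli).symm)
    (fun l hl hli _ => (hwu l hl hli).symm) 1 (k - 1) (by omega) (by omega) hcomb hcomb
  subst this
  omega

/-- A planar face `W` of the polytope through two opposite corners `u` and `o` of a square of side
`k` does not contain the unit edge from `u` to `w` along the boundary of the square: the convex
chain that continues this edge would have to rise too fast. -/
theorem IsVeryFarPair.not_square (h : IsVeryFarPair k J V u v) (hk : 3 ≤ k) {i j : ι} (hi : i ∈ J)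
    (hj : j ∈ J) (hij : i ≠ j) {s t : Bool} (hui : height k s i u = 0) (huj : height k t j u = 0)
    {W : Finset (ι → ℤ)} (hW : IsFace W V)
    (hWu : ∀ x ∈ W, ∀ l ∈ J, l ≠ i → l ≠ j → x l = u l) {o w : ι → ℤ} (ho : o ∈ W)
    (hoi : height k (!s) i o = 0) (hw : w ∈ W) (huw : (edgeGraph V).Adj u w)
    (hwi : height k s i w = 1) (hwj : height k t j w = 0) : False := by
  have hWV := hW.subset
  have hexp : ∀ p ∈ W, IsExposedPoint W p := fun p hp => (h.cvs.exposed p (hWV hp)).anti hWV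
  have hai := h.add hi s
  have haj := h.add hj t
  obtain ⟨y, hwy, hlt⟩ := exists_adj_lt hexp (isAffine_height k (!s) i) hw ho
    (by rw [hoi, height_not]; omega)
  have hwy' := hW.edgeGraph_le hwy
  have hy := hwy.2.2.1
  have hry := (Reach.of_adj huw).trans (Reach.of_adj hwy')
  have h1 := h.one i hi (!s) y (hWV hy) v h.right _ _ hry (Reach.refl v)
  obtain ⟨z, hz, hzi, hrz⟩ := exists_reach_min hexp (isAffine_height k (!s) i)
    (fun x hx => h.cvs.height_nonneg (hWV hx) (!s) i) ⟨o, ho, hoi⟩ hy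
  have h2 := h.two i hi j hj hij (!s) (!t) ⟨v, h.right, by rw [height_not]; omega,
    by rw [height_not]; omega⟩ z (hWV hz) v h.right _ _ (hry.trans (hrz.of_face hW)) (Reach.refl v)
  simp only [height_not] at h1 h2 hlt hzi
  have hyj := h.cvs.height_nonneg (hWV hy) t j
  have hzj := h.cvs.height_nonneg (hWV hz) t j
  have e0 : ∀ l ∈ J, l ≠ i → l ≠ j → u l = w l := fun l a b c => (hWu w hw l a b c).symm
  have e1 : ∀ x ∈ W, ∀ l ∈ J, l ≠ i → l ≠ j → x l = w l := fun x hx l a b c =>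
    (hWu x hx l a b c).trans (e0 l a b c)
  have hyi : height k s i y = 2 := by omega
  have hzi' : height k s i z = k := by omega
  rcases hyj.eq_or_lt with hy0 | hy0
  · exact huw.1 (h.cvs.eq_of_combination s t (hWV hw) h.left (hWV hy) e0 (e1 y hy) 1 1 (by omega)
      (by omega) (by omega) (by omega))
  rcases hzj.eq_or_lt with hz0 | hz0
  · have hzw := h.cvs.eq_of_combination s t (hWV hw) (hWV hz) h.left (e1 z hz) e0 1 (k - 1)
      (by omega) (by omega) (by rw [hzi', hui, hwi]; ring) (by rw [← hz0, huj, hwj]; ring)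
    rw [hzw] at hzi'
    omega
  · refine h.cvs.not_separated s t hwy' h.left (hWV hz) (e1 y hy) e0 (e1 z hz) ?_ ?_
    · rw [hyi, hwi, hwj, hui, huj]
      ring_nf
      omega
    · rw [hyi, hwi, hwj, hzi', show height k t j z = 1 by omega]
      nlinarith

/-- Very far pairs do not exist. The vertices `u` and `v` would be opposite corners of the cube, and
a saving path from `u` to the intersection of the two walls through `v` in directions `i` and `j`
would end at a corner of the cube that differs from `u` only in these two directions. The planar
face containing these two corners contradicts `not_square`. -/
theorem IsVeryFarPair.false [DecidableEq ι] (h : IsVeryFarPair k J V u v) (hk : 3 ≤ k)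
    (hJ : J.Nonempty) : False := by
  have hsingle : ∀ w, (edgeGraph V).Adj u w → ∀ i ∈ J, ∀ j ∈ J, i ≠ j → w i ≠ u i → w j = u j :=
    fun w hw i hi j hj hij hwi => h.not_double hk hi hj hij hw hwi
  have hcor : ∀ i, ∃ s, i ∈ J → height k s i u = 0 := by
    intro i
    by_cases hi : i ∈ J
    · obtain ⟨s, hs⟩ := h.exists_height_eq_zero hsingle hi
      exact ⟨s, fun _ => hs⟩
    · exact ⟨true, fun h => absurd h hi⟩
  choose σ hσ using hcor
  have hv : ∀ l ∈ J, height k (!σ l) l v = 0 := by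
    intro l hl
    have := h.add hl (σ l)
    have := hσ l hl
    rw [height_not]
    omega
  obtain ⟨i, hi⟩ := hJ
  obtain ⟨u', hu', h1, h2⟩ := h.cvs.exists_reach_wall (h.wall i hi (!σ i)) h.left
  have hui := hσ i hi
  rw [height_not, hui] at h2
  obtain ⟨j, hj, hji, hjne⟩ : ∃ j ∈ J, j ≠ i ∧ u' j ≠ u j := by
    by_contra hcon
    push Not at hcon
    exact h.not_cube_edge (by omega) hsingle hi hui hu' h1 hcon
  have huj := hσ j hj
  have h3 := h.two i hi j hj hji.symm (!σ i) (!σ j) ⟨v, h.right, hv i hi, hv j hj⟩ u' hu' v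
    h.right _ _ h2 (Reach.refl v)
  rw [hv i hi, hv j hj, h1, height_not] at h3
  have h4 := h.cvs.height_nonneg hu' (σ j) j
  have h5 : height k (σ j) j u' ≠ height k (σ j) j u := fun h => hjne (height_eq_iff.1 h)
  obtain ⟨o, ho, hoi, hoj, hr⟩ := h.toIsFarPair.exists_reach_two
    ⟨v, h.right, hv i hi, hv j hj⟩ hu'
  have hou : ∀ l ∈ J, l ≠ i → l ≠ j → o l = u l := fun l hl hli hlj =>
    (h.saving_path hi hj hji.symm ho hoi hoj
      ((h2.trans hr).mono (by simp only [height_not] at h1 ⊢; omega)) hl hli hlj).1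
  -- The face on which all coordinates but the `i`-th and the `j`-th agree with those of `u`.
  have hnn : ∀ x ∈ V, ∀ l ∈ (J.erase i).erase j, 0 ≤ height k (σ l) l x := fun x hx l _ =>
    h.cvs.height_nonneg hx _ _
  have hW : IsFace (V.filter fun x => ∑ l ∈ (J.erase i).erase j, height k (σ l) l x = 0) V :=
    isFace_filter (IsAffine.sum _ fun l => isAffine_height k (σ l) l)
      fun x hx => Finset.sum_nonneg (hnn x hx)
  set W := V.filter fun x => ∑ l ∈ (J.erase i).erase j, height k (σ l) l x = 0 with hWdef
  have hmem : ∀ x, x ∈ W ↔ x ∈ V ∧ ∀ l ∈ J, l ≠ i → l ≠ j → x l = u l := by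
    intro x
    rw [hWdef, Finset.mem_filter]
    refine and_congr_right fun hx => ?_
    rw [Finset.sum_eq_zero_iff_of_nonneg (hnn x hx)]
    constructor
    · intro hx0 l hl hli hlj
      exact (height_eq_iff (k := k) (s := σ l)).1 ((hx0 l (Finset.mem_erase.2
        ⟨hlj, Finset.mem_erase.2 ⟨hli, hl⟩⟩)).trans (hσ l hl).symm)
    · intro hx0 l hl
      obtain ⟨hlj, hl⟩ := Finset.mem_erase.1 hl
      obtain ⟨hli, hl⟩ := Finset.mem_erase.1 hl
      exact (height_eq_iff.2 (hx0 l hl hli hlj)).trans (hσ l hl)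
  have hoW : o ∈ W := (hmem o).2 ⟨ho, hou⟩
  have huW : u ∈ W := (hmem u).2 ⟨h.left, fun _ _ _ _ => rfl⟩
  have hWu : ∀ x ∈ W, ∀ l ∈ J, l ≠ i → l ≠ j → x l = u l := fun x hx => ((hmem x).1 hx).2
  obtain ⟨w, huw, hlt⟩ := exists_adj_lt
    (fun p hp => (h.cvs.exposed p (hW.subset hp)).anti hW.subset)
    ((isAffine_height k (!σ i) i).add (isAffine_height k (!σ j) j)) huW hoW
    (by rw [hoi, hoj, height_not, height_not]; omega)
  have hw := huw.2.2.1
  have huw' := hW.edgeGraph_le huw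
  have h6 := h.one i hi (!σ i) w (hW.subset hw) v h.right _ _ (Reach.of_adj huw') (Reach.refl v)
  have h7 := h.one j hj (!σ j) w (hW.subset hw) v h.right _ _ (Reach.of_adj huw') (Reach.refl v)
  have h8 := h.cvs.height_nonneg (hW.subset hw) (σ i) i
  have h9 := h.cvs.height_nonneg (hW.subset hw) (σ j) j
  rw [hv i hi] at h6
  rw [hv j hj] at h7
  simp only [height_not] at hlt h6 h7
  by_cases hwi : w i = u i
  · have hwi' := (height_eq_iff (k := k) (s := σ i)).2 hwi
    exact h.not_square hk hj hi hji huj hui hW (fun x hx l hl hlj hli => hWu x hx l hl hli hlj)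
      hoW hoj hw huw' (by omega) (by omega)
  · have hwj' := (height_eq_iff (k := k) (s := σ j)).2 (hsingle w huw' i hi j hj hji.symm hwi)
    exact h.not_square hk hi hj hji.symm hui huj hW hWu hoW hoi hw huw' (by omega) (by omega)

/-! ### Recursive bounds -/

section Recursion

variable {n : ℕ} {N N₁ N₂ N₃ : ℤ} [DecidableEq ι]

theorem DiamBound.succ (hN : DiamBound ι k n N) : DiamBound ι k (n + 1) (N + k) := by
  intro J V hJ hV u hu v hv
  by_contra hfar
  have h := hV.isFarPair hN hJ hu hv fun h => hfar (h.mono (by omega))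
  obtain ⟨i, hi⟩ := Finset.card_pos.1 (by omega : 0 < J.card)
  have h1 := h.add hi true
  exact hfar ((hV.reach_through hN hJ hi (fun x hx => hV.height_nonneg hx true i)
    (h.wall i hi true) hu hv).mono (by omega))

/-- Two directions save one step over the generic estimate. -/
theorem DiamBound.add_two (hk : 2 ≤ k) (hN₁ : DiamBound ι k (n + 1) N₁)
    (hN₂ : DiamBound ι k n N₂) (h₁ : N₁ + k - 1 ≤ N) (h₂ : N₂ + 2 * k - 1 ≤ N) :
    DiamBound ι k (n + 2) N := by
  intro J V hJ hV u hu v hv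
  by_contra hfar
  have h := hV.isFarPair hN₁ hJ hu hv fun h => hfar (h.mono h₁)
  have htwo : ∀ i ∈ J, ∀ j ∈ J, i ≠ j → ∀ s t,
      (∃ x ∈ V, height k s i x = 0 ∧ height k t j x = 0) → ∀ y ∈ V, ∀ a, Reach V a u y →
      2 * k ≤ a + (height k s i y + height k t j y) + (height k s i v + height k t j v) := by
    intro i hi j hj hij s t hQ y hy a ha
    by_contra hlt
    exact hfar ((ha.trans (hV.reach_two hN₂ hJ hi hj hij hQ hy hv)).mono (by omega))
  have hsingle : ∀ w, (edgeGraph V).Adj u w → ∀ i ∈ J, ∀ j ∈ J, i ≠ j → w i ≠ u i →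
      w j = u j := by
    intro w huw i hi j hj hij hwi
    by_contra hwj
    obtain ⟨s, hs⟩ := h.exists_height_sub_one hi huw hwi
    obtain ⟨t, ht⟩ := h.exists_height_sub_one hj huw hwj
    obtain ⟨u', hu', h1, h2⟩ := hV.exists_reach_wall (h.wall i hi s) hu
    obtain ⟨v', hv', h3, h4⟩ := hV.exists_reach_wall (h.wall i hi s) hv
    have hai := h.add hi s
    have haj := h.add hj t
    have hface := isFace_filter (isAffine_height k s i)
      fun x (hx : x ∈ V) => hV.height_nonneg hx s i
    have hfp := (hV.slice s i 0).isFarPair hN₂ (u := u') (v := v')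
      (by rw [Finset.card_erase_of_mem hi, hJ]; rfl) (Finset.mem_filter.2 ⟨hu', h1⟩)
      (Finset.mem_filter.2 ⟨hv', h3⟩)
      fun h => hfar (((h2.trans (h.of_face hface)).trans h4.symm).mono (by omega))
    obtain ⟨x, hx, hx0⟩ := hfp.wall j (Finset.mem_erase.2 ⟨hij.symm, hj⟩) t
    rw [Finset.mem_filter] at hx
    have := htwo i hi j hj hij s t ⟨x, hx.1, hx.2, hx0⟩ w huw.2.2.1 1 (Reach.of_adj huw)
    omega
  obtain ⟨i, hi⟩ := Finset.card_pos.1 (by omega : 0 < J.card)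
  obtain ⟨s, hs⟩ := h.exists_height_eq_zero hsingle hi
  obtain ⟨u', hu', h1, h2⟩ := hV.exists_reach_wall (h.wall i hi (!s)) hu
  refine h.not_cube_edge hk hsingle hi hs hu' h1 fun l hl hli => ?_
  obtain ⟨t, ht⟩ := h.exists_height_eq_zero hsingle hl
  have h3 := h.add hi s
  have h4 := h.add hl t
  have h5 := htwo i hi l hl hli.symm (!s) (!t) ⟨v, hv, by rw [height_not]; omega,
    by rw [height_not]; omega⟩ u' hu' _ h2
  have h6 := hV.height_nonneg hu' t l
  simp only [height_not] at h1 h5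
  exact (height_eq_iff (k := k) (s := t)).1 (by omega)

/-- Three directions save two steps over the generic estimate, unless one direction saves one
step, or two directions save two. -/
theorem DiamBound.add_three (hk : 3 ≤ k) (hN₁ : DiamBound ι k (n + 2) N₁)
    (hN₂ : DiamBound ι k (n + 1) N₂) (hN₃ : DiamBound ι k n N₃) (h₁ : N₁ + k - 1 ≤ N)
    (h₂ : N₂ + 2 * k - 2 ≤ N) (h₃ : N₃ + 3 * k - 2 ≤ N) : DiamBound ι k (n + 3) N := by
  intro J V hJ hV u hu v hv
  by_contra hfar
  exact (hV.isVeryFarPair hN₁ hN₂ hN₃ hJ hu hv h₁ h₂ h₃ hfar).false hk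
    (Finset.card_pos.1 (by omega))

end Recursion

/-! ### Segments and polygons -/

theorem diamBound_one : DiamBound ι k 1 1 := by
  intro J V hJ hV u hu v hv
  obtain ⟨i, rfl⟩ := Finset.card_eq_one.1 hJ
  have hinj : ∀ x ∈ V, ∀ y ∈ V, x i = y i → x = y := fun x hx y hy hxy =>
    hV.eq_of_height (k := k) hx hy (fun _ => true) fun l hl => by
      rw [Finset.mem_singleton.1 hl]
      exact height_eq_iff.2 hxy
  have hbetween : ∀ x ∈ V, ∀ p ∈ V, ∀ y ∈ V, ¬ (x i < p i ∧ p i < y i) := by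
    rintro x hx p hp y hy ⟨hxp, hpy⟩
    have hcomb : (y i - p i) * height k true i x + (p i - x i) * height k true i y =
        (y i - p i + (p i - x i)) * height k true i p := by
      simp only [height, if_true]
      ring
    have := hV.eq_of_combination (i := i) (j := i) true true hp hx hy
      (fun l hl hli => absurd (Finset.mem_singleton.1 hl) hli)
      (fun l hl hli => absurd (Finset.mem_singleton.1 hl) hli) (y i - p i) (p i - x i) (by omega)
      (by omega) hcomb hcomb
    rw [this] at hxp
    exact lt_irrefl _ hxp
  by_cases huv : u = v
  · exact huv ▸ (Reach.refl u).mono (by omega)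
  · refine Reach.of_adj ⟨huv, hu, hv, 0, rfl, fun x hx hxu hxv => ?_⟩
    exfalso
    have h1 : u i ≠ v i := fun h => huv (hinj u hu v hv h)
    have h2 : x i ≠ u i := fun h => hxu (hinj x hx u hu h)
    have h3 : x i ≠ v i := fun h => hxv (hinj x hx v hv h)
    have b1 := hbetween x hx u hu v hv
    have b2 := hbetween x hx v hv u hu
    have b3 := hbetween u hu x hx v hv
    have b4 := hbetween u hu v hv x hx
    have b5 := hbetween v hv u hu x hx
    have b6 := hbetween v hv x hx u hu
    omega

theorem IsFarPair.exists_reach_height (h : IsFarPair k J V u v) {i : ι} (hi : i ∈ J) {s : Bool}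
    {α : ℤ} (h0 : 0 ≤ α) (hα : α ≤ height k s i u) :
    ∃ p ∈ V, height k s i p = α ∧ Reach V (height k s i u - α) u p := by
  obtain ⟨m, hm⟩ := Int.eq_ofNat_of_zero_le (sub_nonneg.2 hα)
  induction m generalizing α with
  | zero => exact ⟨u, h.left, by omega, (Reach.refl u).mono (by omega)⟩
  | succ m ih =>
    obtain ⟨p, hp, h1, h2⟩ := ih (α := α + 1) (by omega) (by omega) (by push_cast at hm; omega)
    obtain ⟨x, hx, hx0⟩ := h.wall i hi s
    obtain ⟨q, hpq, hlt⟩ := exists_adj_lt h.cvs.exposed (isAffine_height k s i) hp hx (by omega)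
    have hr := h2.trans (Reach.of_adj hpq)
    have h3 := h.one i hi s q hpq.2.2.1 v h.right _ _ hr (Reach.refl v)
    have h4 := h.add hi s
    exact ⟨q, hpq.2.2.1, by omega, hr.mono (by omega)⟩

/-- If `u` and `v` are at distance greater than `k`, then the paths from `u` and from `v` to the two
walls in direction `i` do not meet, so that every slice contains two vertices. -/
theorem IsFarPair.exists_two_in_slice (h : IsFarPair k J V u v) (hfar : ¬ Reach V k u v) {i : ι}
    (hi : i ∈ J) {α : ℤ} (h0 : 0 ≤ α) (hα : α ≤ k) :
    ∃ p ∈ V, ∃ q ∈ V, p i = α ∧ q i = α ∧ p ≠ q := by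
  have haux : ∀ u v, IsFarPair k J V u v → ∃ p ∈ V, p i = α ∧ Reach V |u i - α| u p := by
    intro u v h
    rcases le_total α (u i) with hle | hle
    · obtain ⟨p, hp, h1, h2⟩ := h.exists_reach_height hi (s := true) h0 hle
      exact ⟨p, hp, h1, h2.mono (le_abs_self _)⟩
    · obtain ⟨p, hp, h1, h2⟩ := h.exists_reach_height hi (s := false) (α := k - α) (by omega)
        (by simp only [height]; simp; omega)
      simp only [height, Bool.false_eq_true, if_false] at h1 h2
      refine ⟨p, hp, by omega, h2.mono ?_⟩
      rw [abs_of_nonpos (by omega)]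
      omega
  obtain ⟨p, hp, h1, h2⟩ := haux u v h
  obtain ⟨q, hq, h3, h4⟩ := haux v u h.symm
  refine ⟨p, hp, q, hq, h1, h3, ?_⟩
  rintro rfl
  have h5 : u i + v i = k := h.add hi true
  have h6 := h.cvs.cube u h.left i
  have h7 := h.cvs.cube v h.right i
  refine hfar ((h2.trans h4.symm).mono ?_)
  rcases abs_cases (u i - α) with ⟨h8, h9⟩ | ⟨h8, h9⟩ <;>
    rcases abs_cases (v i - α) with ⟨h10, h11⟩ | ⟨h10, h11⟩ <;> omega

/-- A strictly concave integer sequence of length `n + 1` with positive ends takes values greater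
than `n`. -/
theorem not_strictConcave_le {n : ℕ} (hn : 4 ≤ n) {w : ℕ → ℤ} (h0 : 1 ≤ w 0) (h1 : 1 ≤ w n)
    (hle : w 2 ≤ n) (hw : ∀ m, m + 2 ≤ n → w m + w (m + 2) ≤ 2 * w (m + 1) - 2) : False := by
  have key : ∀ m : ℕ, m + 2 ≤ n →
      w (m + 2) - w (m + 1) ≤ w 2 - w 1 - 2 * m ∧
      w (m + 2) ≤ w 2 + m * (w 2 - w 1) - m * (m + 1) := by
    intro m
    induction m with
    | zero => intro _; simp
    | succ m ih =>
      intro hm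
      obtain ⟨h2, h3⟩ := ih (by omega)
      have h4 := hw (m + 1) (by omega)
      push_cast
      constructor
      · linarith
      · nlinarith
  obtain ⟨m, rfl⟩ : ∃ m, n = m + 2 := ⟨n - 2, by omega⟩
  have h2 := (key m le_rfl).2
  have h3 := hw 0 (by omega)
  push_cast at hle hn
  have hm : (2 : ℤ) ≤ m := by exact_mod_cast (by omega : 2 ≤ m)
  simp only [Nat.zero_add] at h3
  have h4 : 2 * (w 2 - w 1) ≤ m - 1 := by linarith
  nlinarith

theorem diamBound_two [DecidableEq ι] (hk : 4 ≤ k) : DiamBound ι k 2 k := by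
  intro J V hJ hV u hu v hv
  by_contra hfar
  have h := hV.isFarPair diamBound_one hJ hu hv fun h => hfar (h.mono (by omega))
  obtain ⟨i, j, hij, rfl⟩ := Finset.card_eq_two.1 hJ
  obtain ⟨n, rfl⟩ := Int.eq_ofNat_of_zero_le (by omega : 0 ≤ k)
  have hcol : ∀ m : ℕ, ∃ p q : ι → ℤ, m ≤ n → p ∈ V ∧ q ∈ V ∧ p i = m ∧ q i = m ∧ q j < p j := by
    intro m
    by_cases hm : m ≤ n
    · obtain ⟨p, hp, q, hq, h1, h2, hne⟩ := h.exists_two_in_slice hfar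
        (Finset.mem_insert_self i {j}) (α := m) (by omega) (by exact_mod_cast hm)
      have hj : p j ≠ q j := fun hj => hne <| hV.eq_of_height (k := n) hp hq (fun _ => true) <| by
        intro l hl
        rw [height_eq_iff]
        rcases Finset.mem_insert.1 hl with rfl | hl
        · omega
        · rw [Finset.mem_singleton.1 hl, hj]
      rcases lt_or_gt_of_ne hj with h3 | h3
      · exact ⟨q, p, fun _ => ⟨hq, hp, h2, h1, h3⟩⟩
      · exact ⟨p, q, fun _ => ⟨hp, hq, h1, h2, h3⟩⟩
    · exact ⟨0, 0, fun h => absurd h hm⟩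
  choose p q hpq using hcol
  -- No vertex lies in the triangle spanned by the vertices `x`, `y` of the two adjacent columns
  -- and the vertex `b` of its own column.
  have htri : ∀ x ∈ V, ∀ y ∈ V, ∀ a ∈ V, ∀ b ∈ V, x i + y i = 2 * a i → b i = a i → x i ≠ a i →
      ∀ D E : ℤ, 0 ≤ D → 0 < E → E * (x j + y j - 2 * a j) = D * (a j - b j) → False := by
    intro x hx y hy a ha b hb h1 h2 h3 D E hD hE h4
    obtain ⟨φ, hφ⟩ := hV.exposed a ha
    have h5 : E • (x + y) + D • b = (2 * E + D) • a := by
      ext l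
      simp only [Pi.add_apply, Pi.smul_apply, smul_eq_mul]
      by_cases hli : l = i
      · subst hli
        rw [h2]
        linear_combination E * h1
      by_cases hlj : l = j
      · subst hlj
        linear_combination h4
      · have hl : l ∉ ({i, j} : Finset ι) := by simp [hli, hlj]
        rw [hV.const x hx a ha l hl, hV.const y hy a ha l hl, hV.const b hb a ha l hl]
        ring
    have h6 := congrArg φ h5
    rw [map_add, map_zsmul, map_add, map_zsmul, map_zsmul] at h6
    simp only [zsmul_eq_mul] at h6
    push_cast at h6
    have h7 := hφ x hx fun h => h3 (by rw [h])
    have h8 := hφ y hy fun h => h3 (by rw [h] at h1; omega)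
    have h9 : φ a ≤ φ b := by
      by_cases hab : b = a
      · rw [hab]
      · exact (hφ b hb hab).le
    have h10 : (0 : ℝ) < E := by exact_mod_cast hE
    have h11 : (0 : ℝ) ≤ D := by exact_mod_cast hD
    nlinarith
  refine not_strictConcave_le (n := n) (w := fun m => p m j - q m j) (by omega) ?_ ?_ ?_ ?_
  · have := (hpq 0 (by omega)).2.2.2.2
    omega
  · have := (hpq n le_rfl).2.2.2.2
    omega
  · obtain ⟨h1, h2, -⟩ := hpq 2 (by omega)
    have := hV.cube _ h1 j
    have := hV.cube _ h2 j
    omega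
  · intro m hm
    obtain ⟨a1, a2, a3, a4, a5⟩ := hpq m (by omega)
    obtain ⟨b1, b2, b3, b4, b5⟩ := hpq (m + 1) (by omega)
    obtain ⟨c1, c2, c3, c4, c5⟩ := hpq (m + 2) hm
    push_cast at b3 b4 c3 c4
    have hp : p m j + p (m + 2) j < 2 * p (m + 1) j := by
      by_contra hcon
      exact htri _ a1 _ c1 _ b1 _ b2 (by omega) (by omega) (by omega)
        (p m j + p (m + 2) j - 2 * p (m + 1) j) (p (m + 1) j - q (m + 1) j) (by omega) (by omega)
        (by ring)
    have hq : 2 * q (m + 1) j < q m j + q (m + 2) j := by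
      by_contra hcon
      exact htri _ a2 _ c2 _ b2 _ b1 (by omega) (by omega) (by omega)
        (2 * q (m + 1) j - q m j - q (m + 2) j) (p (m + 1) j - q (m + 1) j) (by omega) (by omega)
        (by ring)
    omega

end

/-! ### Solving the recursion -/

section

variable {ι : Type*} {k : ℤ}

theorem diamBound_of_four_le [DecidableEq ι] (hk : 4 ≤ k) (n : ℕ) (hn : 1 ≤ n) :
    DiamBound ι k n (k * n - (2 * n + 2) / 3 - (k - 2)) := by
  induction n using Nat.strong_induction_on with
  | _ n ih =>
    obtain rfl | rfl | rfl | ⟨m, rfl⟩ : n = 1 ∨ n = 2 ∨ n = 3 ∨ ∃ m, n = m + 1 + 3 := by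
      by_cases h : 4 ≤ n
      · exact Or.inr (Or.inr (Or.inr ⟨n - 4, by omega⟩))
      · omega
    · convert (diamBound_one : DiamBound ι k 1 1) using 1
      push_cast
      omega
    · convert (diamBound_two hk : DiamBound ι k 2 k) using 1
      push_cast
      omega
    · convert (diamBound_two hk : DiamBound ι k 2 k).succ using 1
      push_cast
      omega
    · refine DiamBound.add_three (by omega) (ih (m + 3) (by omega) (by omega))
        (ih (m + 2) (by omega) (by omega)) (ih (m + 1) (by omega) (by omega)) ?_ ?_ ?_ <;>
      · push_cast
        simp only [mul_add]
        omega

theorem diamBound_three [DecidableEq ι] (n : ℕ) (hn : 1 ≤ n) :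
    DiamBound ι 3 n (if n % 3 = 2 then 7 * n / 3 else 7 * n / 3 - 1) := by
  induction n using Nat.strong_induction_on with
  | _ n ih =>
    obtain rfl | rfl | rfl | ⟨m, rfl⟩ : n = 1 ∨ n = 2 ∨ n = 3 ∨ ∃ m, n = m + 1 + 3 := by
      by_cases h : 4 ≤ n
      · exact Or.inr (Or.inr (Or.inr ⟨n - 4, by omega⟩))
      · omega
    · exact diamBound_one
    · exact diamBound_one.succ
    · exact (diamBound_one.succ.add_two (by norm_num) diamBound_one (by norm_num) (by norm_num) :
        DiamBound ι 3 3 6)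
    · refine DiamBound.add_three (by omega) (ih (m + 3) (by omega) (by omega))
        (ih (m + 2) (by omega) (by omega)) (ih (m + 1) (by omega) (by omega)) ?_ ?_ ?_ <;>
      · push_cast
        split_ifs <;> omega

end

/-! ### From lattice points to polytopes -/

section

variable {d : ℕ} {k : ℕ} {P : Set (Fin d → ℝ)}

/-- An integer point, viewed as a point of real space. -/
def realPoint {d : ℕ} (z : Fin d → ℤ) : Fin d → ℝ := fun i => z i

theorem realPoint_injective : Function.Injective (realPoint (d := d)) := by
  intro x y h
  ext i
  have := congrFun h i
  simpa [realPoint] using this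

theorem exists_linearMap_realPoint (φ : (Fin d → ℤ) →+ ℝ) :
    ∃ ψ : (Fin d → ℝ) →ₗ[ℝ] ℝ, ∀ z, ψ (realPoint z) = φ z := by
  refine ⟨∑ i, (φ (Pi.single i 1)) • LinearMap.proj i, fun z => ?_⟩
  have hz : z = ∑ i, z i • (Pi.single i 1 : Fin d → ℤ) := by
    ext j
    simp [Finset.sum_apply, Pi.single_apply]
  conv_rhs => rw [hz, map_sum]
  rw [LinearMap.sum_apply]
  refine Finset.sum_congr rfl fun i _ => ?_
  rw [map_zsmul, zsmul_eq_mul, LinearMap.smul_apply, LinearMap.proj_apply, smul_eq_mul, mul_comm]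
  rfl

/-- The points of the convex hull of `E` at which a functional is minimal form the segment between
`p` and `q` when these are the only points of `E` at which it is minimal. -/
theorem isExtreme_segment {E : Set (Fin d → ℝ)} {p q : Fin d → ℝ} (hp : p ∈ E) (hq : q ∈ E)
    (ψ : (Fin d → ℝ) →ₗ[ℝ] ℝ) (hpq : ψ p = ψ q) (hψ : ∀ x ∈ E, x ≠ p → x ≠ q → ψ p < ψ x) :
    IsExtreme ℝ (convexHull ℝ E) (segment ℝ p q) := by
  have hseg : ∀ x ∈ segment ℝ p q, ψ x = ψ p := by
    rintro x ⟨a, b, -, -, hab, rfl⟩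
    rw [map_add, map_smul, map_smul, ← hpq, ← add_smul, hab, one_smul]
  have hconv : Convex ℝ (segment ℝ p q ∪ {x | ψ p < ψ x}) := by
    rw [convex_iff_forall_pos]
    intro x hx y hy a b ha hb hab
    have hge : ∀ z ∈ segment ℝ p q ∪ {x | ψ p < ψ x}, ψ p ≤ ψ z := by
      rintro z (hz | hz)
      · exact (hseg z hz).ge
      · exact le_of_lt hz
    have hx' := hge x hx
    have hy' := hge y hy
    have hcomb : ψ (a • x + b • y) = a * ψ x + b * ψ y := by
      rw [map_add, map_smul, map_smul, smul_eq_mul, smul_eq_mul]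
    have hm : ψ p = a * ψ p + b * ψ p := by rw [← add_mul, hab, one_mul]
    rcases hx with hx | hx
    · rcases hy with hy | hy
      · exact Or.inl (convex_segment p q hx hy ha.le hb.le hab)
      · right
        have h1 := mul_lt_mul_of_pos_left (show ψ p < ψ y from hy) hb
        have h2 := mul_le_mul_of_nonneg_left hx' ha.le
        change ψ p < _
        rw [hcomb]
        linarith
    · right
      have h1 := mul_lt_mul_of_pos_left (show ψ p < ψ x from hx) ha
      have h2 := mul_le_mul_of_nonneg_left hy' hb.le
      change ψ p < _
      rw [hcomb]
      linarith
  have hsub : convexHull ℝ E ⊆ segment ℝ p q ∪ {x | ψ p < ψ x} := by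
    refine convexHull_min (fun x hx => ?_) hconv
    by_cases hxp : x = p
    · exact Or.inl (hxp ▸ left_mem_segment ℝ p q)
    by_cases hxq : x = q
    · exact Or.inl (hxq ▸ right_mem_segment ℝ p q)
    · exact Or.inr (hψ x hx hxp hxq)
  refine ⟨segment_subset_convexHull hp hq, ?_⟩
  rintro x hx y hy z hz ⟨a, b, ha, hb, hab, rfl⟩
  rcases hsub hx with h | h
  · exact h
  have h1 := hseg _ hz
  rw [map_add, map_smul, map_smul, smul_eq_mul, smul_eq_mul] at h1
  have h2 : ψ p ≤ ψ y := by
    rcases hsub hy with h | h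
    · exact (hseg _ h).ge
    · exact le_of_lt h
  have h3 := mul_lt_mul_of_pos_left (show ψ p < ψ x from h) ha
  have h4 := mul_le_mul_of_nonneg_left h2 hb.le
  have hm : ψ p = a * ψ p + b * ψ p := by rw [← add_mul, hab, one_mul]
  linarith

theorem IsLatticePolytope.finite_vertices (hP : IsLatticePolytope P) :
    (polytopeVertices P).Finite := by
  obtain ⟨S, hS, -, -, rfl⟩ := hP
  exact hS.subset extremePoints_convexHull_subset

theorem IsLatticePolytope.eq_convexHull (hP : IsLatticePolytope P) :
    P = convexHull ℝ (polytopeVertices P) := by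
  have hfin := hP.finite_vertices
  obtain ⟨S, hS, -, -, rfl⟩ := hP
  have h := closure_convexHull_extremePoints (hS.isCompact_convexHull ℝ) (convex_convexHull ℝ S)
  exact ((hfin.isClosed_convexHull ℝ).closure_eq.symm.trans h).symm

/-- The vertices of a lattice `(d, k)`-polytope, as integer points. -/
theorem IsLatticeDKPolytope.exists_isCubeVertexSet (hP : IsLatticeDKPolytope d k P) :
    ∃ V : Finset (Fin d → ℤ), IsCubeVertexSet (k : ℤ) Finset.univ V ∧
      realPoint '' V = polytopeVertices P := by
  classical
  obtain ⟨hlat, hbox⟩ := hP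
  have hfin := hlat.finite_vertices
  have hint : ∀ x ∈ polytopeVertices P, realPoint (fun i => ⌊x i⌋) = x := by
    intro x hx
    ext i
    obtain ⟨n, -, hn⟩ := hbox x hx i
    simp [realPoint, hn]
  refine ⟨hfin.toFinset.image fun x i => ⌊x i⌋, ⟨?_, ?_, ?_⟩, ?_⟩
  · intro p hp
    obtain ⟨x, hx, rfl⟩ := Finset.mem_image.1 hp
    rw [Set.Finite.mem_toFinset] at hx
    have hxP : x ∉ convexHull ℝ (polytopeVertices P \ {x}) := by
      have hconv : Convex ℝ P := by
        rw [hlat.eq_convexHull]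
        exact convex_convexHull ℝ _
      have h := (hconv.mem_extremePoints_iff_mem_sdiff_convexHull_sdiff.1 hx).2
      exact fun h' => h (convexHull_mono (Set.sdiff_subset_sdiff_left extremePoints_subset) h')
    obtain ⟨f, s, h1, h2⟩ := geometric_hahn_banach_point_closed (convex_convexHull ℝ _)
      (Set.Finite.isClosed_convexHull ℝ (hfin.subset Set.sdiff_subset)) hxP
    refine ⟨AddMonoidHom.mk' (fun z => f (realPoint z)) fun a b => ?_, ?_⟩
    · rw [← map_add]
      congr 1
      ext i
      simp [realPoint]
    · intro z hz hne
      obtain ⟨y, hy, rfl⟩ := Finset.mem_image.1 hz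
      rw [Set.Finite.mem_toFinset] at hy
      change f (realPoint _) < f (realPoint _)
      rw [hint x hx, hint y hy]
      exact h1.trans (h2 y (subset_convexHull ℝ _ ⟨hy, fun h => hne (by rw [h])⟩))
  · intro z hz i
    obtain ⟨x, hx, rfl⟩ := Finset.mem_image.1 hz
    rw [Set.Finite.mem_toFinset] at hx
    obtain ⟨n, hn, h⟩ := hbox x hx i
    simp only [h, Int.floor_natCast]
    omega
  · exact fun x _ y _ i hi => absurd (Finset.mem_univ i) hi
  · ext x
    constructor
    · rintro ⟨z, hz, rfl⟩
      obtain ⟨y, hy, rfl⟩ := Finset.mem_image.1 hz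
      rw [Set.Finite.mem_toFinset] at hy
      rwa [hint y hy]
    · intro hx
      exact ⟨_, Finset.mem_image_of_mem _ (hfin.mem_toFinset.2 hx), hint x hx⟩

theorem polytopeDiam_le {N : ℤ} (hN : DiamBound (Fin d) k d N) (hP : IsLatticeDKPolytope d k P) :
    polytopeDiam P ≤ (N.toNat : ℕ∞) := by
  obtain ⟨V, hV, himage⟩ := hP.exists_isCubeVertexSet
  have hPV : P = convexHull ℝ (realPoint '' V) := himage ▸ hP.1.eq_convexHull
  have hadj : ∀ p q, (edgeGraph V).Adj p q →
      IsExtreme ℝ P (segment ℝ (realPoint p) (realPoint q)) := by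
    rintro p q ⟨-, hp, hq, φ, h1, h2⟩
    obtain ⟨ψ, hψ⟩ := exists_linearMap_realPoint φ
    rw [hPV]
    refine isExtreme_segment ⟨p, hp, rfl⟩ ⟨q, hq, rfl⟩ ψ (by rw [hψ, hψ, h1]) ?_
    rintro _ ⟨x, hx, rfl⟩ hxp hxq
    rw [hψ, hψ]
    exact h2 x hx (fun h => hxp (by rw [h])) fun h => hxq (by rw [h])
  have hwalk : ∀ p q, ∀ w : (edgeGraph V).Walk p q, ∀ (hp : realPoint p ∈ polytopeVertices P)
      (hq : realPoint q ∈ polytopeVertices P),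
      ∃ w' : (polytopeGraph P).Walk ⟨realPoint p, hp⟩ ⟨realPoint q, hq⟩,
        w'.length = w.length := by
    intro p q w
    induction w with
    | nil => exact fun hp _ => ⟨SimpleGraph.Walk.nil, rfl⟩
    | @cons a b c hab w ih =>
      intro hp hq
      have hb : realPoint b ∈ polytopeVertices P := himage ▸ ⟨b, hab.2.2.1, rfl⟩
      obtain ⟨w', hw'⟩ := ih hb hq
      have hadj' : (polytopeGraph P).Adj ⟨realPoint a, hp⟩ ⟨realPoint b, hb⟩ :=
        ⟨fun h => hab.1 (realPoint_injective (congrArg Subtype.val h)), hadj a b hab⟩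
      exact ⟨SimpleGraph.Walk.cons hadj' w', by simp [hw']⟩
  refine SimpleGraph.ediam_le_of_edist_le ?_
  rintro ⟨x, hx⟩ ⟨y, hy⟩
  obtain ⟨u, hu, rfl⟩ : x ∈ realPoint '' (V : Set (Fin d → ℤ)) := himage ▸ hx
  obtain ⟨v, hv, rfl⟩ : y ∈ realPoint '' (V : Set (Fin d → ℤ)) := himage ▸ hy
  obtain ⟨w, hw⟩ := hN Finset.univ V (by simp) hV u hu v hv
  obtain ⟨w', hw'⟩ := hwalk u v w hx hy
  refine (SimpleGraph.Walk.edist_le w').trans ?_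
  rw [hw']
  exact_mod_cast (by omega : w.length ≤ N.toNat)

theorem exists_maxLatticeDiam_eq {N : ℤ} (hN : DiamBound (Fin d) k d N) (hN0 : 0 ≤ N) :
    ∃ δ : ℕ, maxLatticeDiam d k = (δ : ℕ∞) ∧ (δ : ℤ) ≤ N := by
  have h : maxLatticeDiam d k ≤ (N.toNat : ℕ∞) := by
    refine sSup_le ?_
    rintro n ⟨P, hP, rfl⟩
    exact polytopeDiam_le hN hP
  obtain ⟨δ, hδ⟩ := ENat.ne_top_iff_exists.1 (ne_top_of_le_ne_top (ENat.natCast_ne_top _) h)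
  rw [← hδ] at h
  exact ⟨δ, hδ.symm, by have := (Nat.cast_le (α := ℕ∞)).1 h; omega⟩

end

theorem theorem2 (d : ℕ) (hd : 1 ≤ d) :
    (∀ k : ℕ, 4 ≤ k → ∃ δ : ℕ, maxLatticeDiam d k = (δ : ℕ∞) ∧
      (δ : ℤ) ≤ (k : ℤ) * (d : ℤ) - ⌈(2 * (d : ℚ)) / 3⌉ - ((k : ℤ) - 2)) ∧
    (¬ d ≡ 2 [MOD 3] → ∃ δ : ℕ, maxLatticeDiam d 3 = (δ : ℕ∞) ∧
      (δ : ℤ) ≤ ⌊(7 * (d : ℚ)) / 3⌋ - 1) ∧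
    (d ≡ 2 [MOD 3] → ∃ δ : ℕ, maxLatticeDiam d 3 = (δ : ℕ∞) ∧
      (δ : ℤ) ≤ ⌊(7 * (d : ℚ)) / 3⌋) := by
  have hfloor : (7 * d / 3 : ℤ) ≤ ⌊(7 * (d : ℚ)) / 3⌋ := by
    rw [Int.le_floor, le_div_iff₀ (by norm_num)]
    exact_mod_cast (by omega : (7 * d / 3 : ℤ) * 3 ≤ 7 * d)
  refine ⟨fun k hk => ?_, fun h => ?_, fun h => ?_⟩
  · have hceil : ⌈(2 * (d : ℚ)) / 3⌉ ≤ (2 * d + 2) / 3 := by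
      rw [Int.ceil_le, div_le_iff₀ (by norm_num)]
      exact_mod_cast (by omega : (2 * d : ℤ) ≤ (2 * d + 2) / 3 * 3)
    obtain ⟨δ, h1, h2⟩ := exists_maxLatticeDiam_eq (d := d)
      (diamBound_of_four_le (by exact_mod_cast hk) d hd) (by
        obtain ⟨e, rfl⟩ : ∃ e, d = e + 1 := ⟨d - 1, by omega⟩
        have h3 : (4 : ℤ) * e ≤ k * e :=
          mul_le_mul_of_nonneg_right (by exact_mod_cast hk) (by omega)
        push_cast
        rw [mul_add]
        omega)
    exact ⟨δ, h1, by omega⟩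
  · have hmod : ¬ d % 3 = 2 := h
    obtain ⟨δ, h1, h2⟩ := exists_maxLatticeDiam_eq (d := d) (k := 3) (diamBound_three d hd)
      (by rw [if_neg hmod]; omega)
    rw [if_neg hmod] at h2
    exact ⟨δ, h1, by omega⟩
  · have hmod : d % 3 = 2 := h
    obtain ⟨δ, h1, h2⟩ := exists_maxLatticeDiam_eq (d := d) (k := 3) (diamBound_three d hd)
      (by rw [if_pos hmod]; omega)
    rw [if_pos hmod] at h2
    exact ⟨δ, h1, by omega⟩
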